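/- **Setting.** Let $U\subset\mathbb R^m$, $G,G_1\subseteq\mathbb R^n$, and let $\mathcal U=L^\infty_{\rm loc}([0,+\infty),U)$ be the class of measurable, locally essentially bounded functions $u:[0,+\infty)\to U$. Consider the control system $\dot x(t)=f(x(t),u(t))$, $x(0)=x_0\in G$, $u\in\mathcal U$, with solutions understood in the sense of Carathéodory (locally absolutely continuous, satisfying the equation almost everywhere). Balls and norms are Euclidean, $\mathrm B_r(\xi)$ denotes the open ball, and an open domain is a nonempty connected open set. A real function on a set is *proper* if preimages of compact sets are compact, and *positive definite* if it vanishes at $0$ and is positive at all other points of its domain. The lower Dini derivative is $\partial^-\varphi(x;v)=\liminf_{h\to0+,\,w\to v}\frac{\varphi(x+hw)-\varphi(x)}{h}\in[-\infty,+\infty]$. **Assumptions on the system.** 1. $U$ is compact, $G,G_1$ are open domains, $\bar G\subseteq G_1$, $0\in G$. 2. $f:G_1\times U\to\mathbb R^n$ is continuous. 3. For every $T\in(0,+\infty]$, $x_0\in G$ and $u\in\mathcal U$, every $G_1$-valued solution of the system on $[0,T)$ stays in $G$. 4. For every $R>0$ there is $C_{1,R}>0$ with $\|f(x,u)-f(x',u)\|\le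 C_{1,R}\|x-x'\|$ for all $x,x'\in\bar{\mathrm B}_R(0)\cap\bar G$ and all $u\in U$. 5. There are a continuously differentiable proper function $Y:G_1\to[0,+\infty)$ and $C_2>0$ with $\langle \mathrm DY(x),f(x,u)\rangle\le C_2Y(x)$ for all $x\in G_1$, $u\in U$. 6. The set $\{f(x,u):u\in U\}$ is convex for every $x\in\bar G$. **Assumptions on the local control Lyapunov function.** 1. $\Omega\subseteq G$ is an open domain with $0\in\Omega$. 2. $V_{\rm loc}:\bar\Omega\to[0,+\infty)$ is continuous, proper and positive definite, and there is a continuous positive definite function $W_{\rm loc}:\Omega\to[0,+\infty)$ with $\inf_{u\in U}\partial^-V_{\rm loc}(x;f(x,u))\le -W_{\rm loc}(x)$ for all $x\in\Omega$. 3. $V_{\rm loc}$ is locally Lipschitz continuous in $\Omega$. 4. $c>0$ is such that $\{x\in\bar\Omega:V_{\rm loc}(x)<c\}$ is an open domain in $\mathbb R^n$ whose closure is $\Omega_c=\{x\in\bar\Omega:V_{\rm loc}(x)\le c\}$, that $\Omega_c+\mathrm B_{C_3}(0)\subseteq\Omega$ for some $C_3>0$, and that $\partial\Omega_c=\{x\in\bar\Omega:V_{\rm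 loc}(x)=c\}$. 5. $\lim_{\varepsilon\to+0}\sup\{\|x\|:x\in\bar\Omega,\ V_{\rm loc}(x)\le\varepsilon\}=0$. Let $\mathcal D_0$ be the set of all $x_0\in G$ for which there is $u\in\mathcal U$ such that the solution $x(t;x_0,u)\in G$ exists for all $t\ge0$ and $\lim_{t\to+\infty}\|x(t;x_0,u)\|=0$. **Proposition.** Under these assumptions, $\mathcal D_0$ is an open domain (a nonempty open connected set) containing $\Omega_c$, and it is weakly invariant: for every $x_0\in\mathcal D_0$ there is $u\in\mathcal U$ such that the solution $x(t;x_0,u)$ exists for all $t\ge0$ and $x(t;x_0,u)\in\mathcal D_0$ for all $t\ge0$. -/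

import Mathlib

open Set Filter Topology MeasureTheory
open scoped Pointwise ENNReal

/-- The class of admissible controls `L^∞_loc([0, +∞), U)`: measurable, essentially bounded on
every bounded time interval, with values in `U`. (Only the values at times `t ≥ 0` matter.) -/
def AdmissibleControls {m : ℕ} (U : Set (EuclideanSpace ℝ (Fin m))) :
    Set (ℝ → EuclideanSpace ℝ (Fin m)) :=
  {u | (∀ T : ℝ, 0 < T → MemLp u ∞ (volume.restrict (Icc 0 T))) ∧ ∀ t : ℝ, 0 ≤ t → u t ∈ U}

/-- `x` is a Carathéodory solution of `x' = f (x, u)`, `x 0 = x₀`, on the time interval `[0, T)`,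
`T ∈ (0, +∞]`, with values in `S`. It is written as the integral equation, which says exactly that
`x` is locally absolutely continuous on `[0, T)`, starts at `x₀` and satisfies the differential
equation almost everywhere. Values of `x` outside `[0, T)` play no role. -/
def IsTrajectory {n m : ℕ}
    (f : EuclideanSpace ℝ (Fin n) → EuclideanSpace ℝ (Fin m) → EuclideanSpace ℝ (Fin n))
    (S : Set (EuclideanSpace ℝ (Fin n))) (T : EReal) (x₀ : EuclideanSpace ℝ (Fin n))
    (u : ℝ → EuclideanSpace ℝ (Fin m)) (x : ℝ → EuclideanSpace ℝ (Fin n)) : Prop :=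
  ∀ t : ℝ, 0 ≤ t → (t : EReal) < T →
    x t ∈ S ∧
    IntervalIntegrable (fun s => f (x s) (u s)) volume 0 t ∧
    x t = x₀ + ∫ s in (0 : ℝ)..t, f (x s) (u s)

/-- The global region of asymptotic null-controllability `𝒟₀`. -/
def nullControllabilityRegion {n m : ℕ} (U : Set (EuclideanSpace ℝ (Fin m)))
    (G : Set (EuclideanSpace ℝ (Fin n)))
    (f : EuclideanSpace ℝ (Fin n) → EuclideanSpace ℝ (Fin m) → EuclideanSpace ℝ (Fin n)) :
    Set (EuclideanSpace ℝ (Fin n)) :=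
  {x₀ | x₀ ∈ G ∧ ∃ u ∈ AdmissibleControls U, ∃ x : ℝ → EuclideanSpace ℝ (Fin n),
    IsTrajectory f G ⊤ x₀ u x ∧ Tendsto (fun t => ‖x t‖) atTop (𝓝 0)}

/-- A real function on `S` is proper if preimages (in `S`) of compact sets are compact. -/
def IsProperFunOn {n : ℕ} (φ : EuclideanSpace ℝ (Fin n) → ℝ)
    (S : Set (EuclideanSpace ℝ (Fin n))) : Prop :=
  ∀ M : Set ℝ, IsCompact M → IsCompact (S ∩ φ ⁻¹' M)

/-- Positive definiteness on a set `S` containing the origin. -/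
def IsPosDefOn {n : ℕ} (φ : EuclideanSpace ℝ (Fin n) → ℝ)
    (S : Set (EuclideanSpace ℝ (Fin n))) : Prop :=
  φ 0 = 0 ∧ ∀ x ∈ S, x ≠ 0 → 0 < φ x

/-- The lower Dini derivative (directional subderivate)
`liminf_{h → 0+, w → v} (φ (x + h w) - φ x) / h`, an extended real number. -/
noncomputable def lowerDini {n : ℕ} (φ : EuclideanSpace ℝ (Fin n) → ℝ)
    (x v : EuclideanSpace ℝ (Fin n)) : EReal :=
  liminf (fun p : ℝ × EuclideanSpace ℝ (Fin n) =>
    (((φ (x + p.1 • p.2) - φ x) / p.1 : ℝ) : EReal)) (𝓝[>] (0 : ℝ) ×ˢ 𝓝 v)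

/-- The standing conditions on the control system. -/
structure SystemConditions {n m : ℕ} (U : Set (EuclideanSpace ℝ (Fin m)))
    (G G₁ : Set (EuclideanSpace ℝ (Fin n)))
    (f : EuclideanSpace ℝ (Fin n) → EuclideanSpace ℝ (Fin m) → EuclideanSpace ℝ (Fin n)) :
    Prop where
  compact_U : IsCompact U
  open_G : IsOpen G
  connected_G : IsConnected G
  open_G₁ : IsOpen G₁
  connected_G₁ : IsConnected G₁
  closure_G_subset : closure G ⊆ G₁
  zero_mem : (0 : EuclideanSpace ℝ (Fin n)) ∈ G
  continuous_f : ContinuousOn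
    (fun p : EuclideanSpace ℝ (Fin n) × EuclideanSpace ℝ (Fin m) => f p.1 p.2) (G₁ ×ˢ U)
  /-- Strong invariance of `G`. -/
  strongly_invariant : ∀ T : EReal, 0 < T → ∀ x₀ ∈ G, ∀ u ∈ AdmissibleControls U,
    ∀ x : ℝ → EuclideanSpace ℝ (Fin n), IsTrajectory f G₁ T x₀ u x →
      ∀ t : ℝ, 0 ≤ t → (t : EReal) < T → x t ∈ G
  lipschitz_f : ∀ R : ℝ, 0 < R → ∃ C : ℝ, 0 < C ∧
    ∀ x ∈ Metric.closedBall 0 R ∩ closure G, ∀ x' ∈ Metric.closedBall 0 R ∩ closure G,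
      ∀ u ∈ U, ‖f x u - f x' u‖ ≤ C * ‖x - x'‖
  growth : ∃ Y : EuclideanSpace ℝ (Fin n) → ℝ, ∃ C₂ : ℝ, 0 < C₂ ∧
    ContDiffOn ℝ 1 Y G₁ ∧ (∀ x ∈ G₁, 0 ≤ Y x) ∧ IsProperFunOn Y G₁ ∧
    ∀ x ∈ G₁, ∀ u ∈ U, fderiv ℝ Y x (f x u) ≤ C₂ * Y x

/-- `V` is a local control Lyapunov function on `closure Ω` and `c` is an admissible level.
Only the values of `V` on `closure Ω` matter: `Ω` is open, so the lower Dini derivatives at points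
of `Ω` depend only on `V` restricted to `Ω`. -/
structure LocalCLFConditions {n m : ℕ} (U : Set (EuclideanSpace ℝ (Fin m)))
    (G : Set (EuclideanSpace ℝ (Fin n)))
    (f : EuclideanSpace ℝ (Fin n) → EuclideanSpace ℝ (Fin m) → EuclideanSpace ℝ (Fin n))
    (Ω : Set (EuclideanSpace ℝ (Fin n))) (V : EuclideanSpace ℝ (Fin n) → ℝ) (c : ℝ) :
    Prop where
  open_Ω : IsOpen Ω
  connected_Ω : IsConnected Ω
  Ω_subset : Ω ⊆ G
  zero_mem : (0 : EuclideanSpace ℝ (Fin n)) ∈ Ω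
  continuous_V : ContinuousOn V (closure Ω)
  proper_V : IsProperFunOn V (closure Ω)
  posDef_V : IsPosDefOn V (closure Ω)
  /-- The infinitesimal decrease condition. -/
  decrease : ∃ W : EuclideanSpace ℝ (Fin n) → ℝ, ContinuousOn W Ω ∧ IsPosDefOn W Ω ∧
    ∀ x ∈ Ω, (⨅ u ∈ U, lowerDini V x (f x u)) ≤ ((-W x : ℝ) : EReal)
  locallyLipschitz_V : LocallyLipschitzOn Ω V
  c_pos : 0 < c
  open_sublevel : IsOpen {x ∈ closure Ω | V x < c}
  connected_sublevel : IsConnected {x ∈ closure Ω | V x < c}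
  closure_sublevel : closure {x ∈ closure Ω | V x < c} = {x ∈ closure Ω | V x ≤ c}
  sublevel_add_ball : ∃ C₃ : ℝ, 0 < C₃ ∧
    {x ∈ closure Ω | V x ≤ c} + Metric.ball (0 : EuclideanSpace ℝ (Fin n)) C₃ ⊆ Ω
  frontier_sublevel : frontier {x ∈ closure Ω | V x ≤ c} = {x ∈ closure Ω | V x = c}
  sublevel_shrink : Tendsto (fun ε : ℝ => ⨆ x ∈ {x ∈ closure Ω | V x ≤ ε}, ‖x‖ₑ)
    (𝓝[>] 0) (𝓝 0)

/-! ### Carathéodory–Peano existence for bounded continuous fields. -/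

section Peano

variable {E E' : Type*} [NormedAddCommGroup E] [NormedSpace ℝ E] [FiniteDimensional ℝ E]
  [MeasurableSpace E] [BorelSpace E] [NormedAddCommGroup E'] [SecondCountableTopology E']
  [MeasurableSpace E'] [BorelSpace E']

/-! Everything rests on steering `Ω_c` to the origin. At a nonzero point the Dini condition, with
the Lipschitz property of `V`, gives a constant control that lowers `V` after some short time
(`exists_control_decrease`). By Grönwall the same control and time serve all nearby points, so
compactness of the shell `ε/4 ≤ V ≤ ε` yields a uniform drop and a uniform minimal duration
(`exists_uniform_decrease`). Finitely many such steps lead from `V ≤ ε` to `V ≤ ε/2` inside `V ≤ 2ε`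
(`exists_reaches_half`). Gluing these arcs for `ε = c/2^k` gives a trajectory that is eventually in
every `V ≤ 2c/2^k`; these sets shrink to the origin.

The rest follows from dynamics. A trajectory tending to `0` enters the open set `V < c` at a finite
time. Grönwall carries this over to nearby initial points under the same control, which gives
openness. The arc up to that time joins its initial point to the connected set `V < c`, which gives
connectedness. Tails of such trajectories have the same property, which gives weak invariance.

Solutions are built by Peano's theorem for a cut-off field; the growth condition on `Y` keeps them
where the cutoff equals one, and strong invariance keeps them in `G`. -/

theorem intervalIntegrable_of_measurable_of_norm_le {g : ℝ → E} {M : ℝ} (hg : Measurable g)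
    (hM : ∀ s, ‖g s‖ ≤ M) (a b : ℝ) : IntervalIntegrable g volume a b :=
  (intervalIntegrable_const (c := M)).mono_fun hg.aestronglyMeasurable
    (ae_of_all _ fun s => (hM s).trans (le_abs_self M))

theorem norm_primitive_sub_le {g : ℝ → E} {M : ℝ} (hg : Measurable g) (hM : ∀ s, ‖g s‖ ≤ M)
    (x₀ : E) (a b : ℝ) :
    ‖(x₀ + ∫ s in (0 : ℝ)..a, g s) - (x₀ + ∫ s in (0 : ℝ)..b, g s)‖ ≤ M * |a - b| := by
  rw [add_sub_add_left_eq_sub, intervalIntegral.integral_interval_sub_left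
    (intervalIntegrable_of_measurable_of_norm_le hg hM _ _)
    (intervalIntegrable_of_measurable_of_norm_le hg hM _ _)]
  exact intervalIntegral.norm_integral_le_of_norm_le_const fun s _ => hM s

/-- Nodes of the Euler polygon with step `τ` for `x' = F (x, u)`. -/
noncomputable def eulerNode (F : E × E' → E) (u : ℝ → E') (x₀ : E) (τ : ℝ) : ℕ → E
  | 0 => x₀
  | j + 1 => eulerNode F u x₀ τ j +
      ∫ s in ((j : ℝ) * τ)..((j + 1 : ℕ) * τ), F (eulerNode F u x₀ τ j, u s)

/-- Each step size admits a polygon whose velocity is frozen along a nearby step function. -/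
theorem exists_euler_polygon {F : E × E' → E} (hF : Continuous F) {M : ℝ} (hM : ∀ p, ‖F p‖ ≤ M)
    {u : ℝ → E'} (hu : Measurable u) (x₀ : E) {τ : ℝ} (hτ : 0 < τ) :
    ∃ z : ℝ → E, Measurable z ∧ ∀ t, 0 ≤ t →
      ‖(x₀ + ∫ s in (0 : ℝ)..t, F (z s, u s)) - z t‖ ≤ M * τ := by
  set p := eulerNode F u x₀ τ with hp
  have hz : Measurable fun s : ℝ => p ⌊s / τ⌋₊ :=
    (measurable_from_nat (f := p)).comp (Nat.measurable_floor.comp (measurable_id.div_const τ))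
  have hg : Measurable fun s : ℝ => F (p ⌊s / τ⌋₊, u s) :=
    hF.measurable.comp (hz.prodMk hu)
  have hint := intervalIntegrable_of_measurable_of_norm_le hg fun s => hM _
  have hnode : ∀ j : ℕ, x₀ + ∫ s in (0 : ℝ)..(j * τ), F (p ⌊s / τ⌋₊, u s) = p j := by
    intro j
    induction j with
    | zero => simp [hp, eulerNode]
    | succ j ih =>
      rw [← intervalIntegral.integral_add_adjacent_intervals (hint 0 (j * τ)) (hint _ _),
        ← add_assoc, ih]
      have : p (j + 1) = p j + ∫ s in ((j : ℝ) * τ)..((j + 1 : ℕ) * τ), F (p j, u s) := rfl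
      rw [this]
      congr 1
      apply intervalIntegral.integral_congr_ae
      -- At the right endpoint of the cell the floor already jumps to `j + 1`; this single point is
      -- null.
      have hne : ∀ᵐ s : ℝ, s ≠ ((j + 1 : ℕ) : ℝ) * τ := compl_mem_ae_iff.2 (measure_singleton _)
      filter_upwards [hne] with s hs hmem
      have hle : (j : ℝ) * τ ≤ ((j + 1 : ℕ) : ℝ) * τ := by
        gcongr
        simp
      rw [uIoc_of_le hle] at hmem
      have : ⌊s / τ⌋₊ = j := by
        have hj : (0 : ℝ) ≤ j * τ := by positivity
        rw [Nat.floor_eq_iff (div_nonneg (hj.trans hmem.1.le) hτ.le), le_div_iff₀ hτ, div_lt_iff₀ hτ]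
        exact ⟨hmem.1.le, by exact_mod_cast lt_of_le_of_ne hmem.2 hs⟩
      rw [this]
  refine ⟨_, hz, fun t ht => ?_⟩
  have h1 := hnode ⌊t / τ⌋₊
  rw [← h1]
  refine (norm_primitive_sub_le hg (fun s => hM _) x₀ _ _).trans ?_
  have hM0 : 0 ≤ M := (norm_nonneg _).trans (hM (x₀, u 0))
  gcongr
  have h2 := Nat.floor_le (div_nonneg ht hτ.le)
  have h3 := Nat.lt_floor_add_one (t / τ)
  rw [le_div_iff₀ hτ] at h2
  rw [div_lt_iff₀ hτ] at h3
  rw [abs_le]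
  constructor <;> nlinarith

/-- Carathéodory–Peano existence for a bounded continuous right-hand side and a measurable
control. -/
theorem exists_solution_of_bounded {F : E × E' → E} (hF : Continuous F) {M : ℝ}
    (hM : ∀ p, ‖F p‖ ≤ M) {u : ℝ → E'} (hu : Measurable u) (x₀ : E) (T : ℝ) :
    ∃ x : ℝ → E, Continuous x ∧ ∀ t ∈ Icc 0 T, x t = x₀ + ∫ s in (0 : ℝ)..t, F (x s, u s) := by
  have hM0 : 0 ≤ M := (norm_nonneg _).trans (hM (x₀, u 0))
  rcases lt_or_ge T 0 with hT | hT
  · exact ⟨fun _ => x₀, continuous_const, fun t ht => absurd (ht.1.trans ht.2) hT.not_ge⟩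
  have hτ : ∀ k : ℕ, (0 : ℝ) < 1 / ((k : ℝ) + 1) := fun k => Nat.one_div_pos_of_nat
  choose z hz hzX using fun k : ℕ => exists_euler_polygon hF hM hu x₀ (hτ k)
  have hg : ∀ k, Measurable fun s => F (z k s, u s) := fun k =>
    hF.measurable.comp ((hz k).prodMk hu)
  set X : ℕ → ℝ → E := fun k t => x₀ + ∫ s in (0 : ℝ)..t, F (z k s, u s) with hX
  have hlip : ∀ k a b, dist (X k a) (X k b) ≤ M * dist a b := fun k a b => by
    rw [dist_eq_norm, Real.dist_eq]
    exact norm_primitive_sub_le (hg k) (fun s => hM _) x₀ a b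
  have hXc : ∀ k, Continuous (X k) := fun k =>
    (LipschitzWith.of_dist_le_mul (K := ⟨M, hM0⟩) fun a b => hlip k a b).continuous
  let Φ : ℕ → BoundedContinuousFunction (Icc (0 : ℝ) T) E := fun k =>
    BoundedContinuousFunction.mkOfCompact ⟨fun t => X k t, (hXc k).comp continuous_subtype_val⟩
  have hcpt : IsCompact (closure (range Φ)) := by
    refine BoundedContinuousFunction.arzela_ascoli (Metric.closedBall x₀ (M * T))
      (isCompact_closedBall _ _) _ ?_ ?_
    · rintro _ t ⟨k, rfl⟩
      have h0 : X k 0 = x₀ := by simp [hX]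
      have := hlip k t 0
      rw [h0] at this
      refine this.trans ?_
      rw [Real.dist_eq, sub_zero, abs_of_nonneg t.2.1]
      exact mul_le_mul_of_nonneg_left t.2.2 hM0
    · refine Metric.equicontinuous_of_continuity_modulus (fun d => M * d) ?_ _ ?_
      · simpa using (continuous_const_mul M).tendsto 0
      · rintro a b ⟨_, k, rfl⟩
        exact hlip k a b
  obtain ⟨φ, -, σ, hσ, hlim⟩ := hcpt.tendsto_subseq fun k => subset_closure (mem_range_self k)
  have hpt : ∀ t : Icc (0 : ℝ) T, Tendsto (fun k => X (σ k) t) atTop (𝓝 (φ t)) := fun t =>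
    (BoundedContinuousFunction.tendsto_iff_tendstoUniformly.1 hlim).tendsto_at t
  refine ⟨fun t => φ (projIcc 0 T hT t), φ.continuous.comp continuous_projIcc, fun t ht => ?_⟩
  refine tendsto_nhds_unique (a := φ (projIcc 0 T hT t)) (b := x₀ + _)
    (f := fun k => X (σ k) t) (l := atTop) ?_ ?_
  · rw [projIcc_of_mem hT ht]
    exact hpt ⟨t, ht⟩
  · refine Tendsto.const_add _ ?_
    refine intervalIntegral.tendsto_integral_filter_of_dominated_convergence (fun _ => M)
      (Eventually.of_forall fun k => (hg _).aestronglyMeasurable)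
      (Eventually.of_forall fun k => ae_of_all _ fun s _ => hM _) intervalIntegrable_const
      (ae_of_all _ fun s hs => ?_)
    rw [uIoc_of_le ht.1] at hs
    have hsT : s ∈ Icc 0 T := ⟨hs.1.le, hs.2.trans ht.2⟩
    refine (hF.tendsto _).comp (Tendsto.prodMk_nhds ?_ tendsto_const_nhds)
    simp only [projIcc_of_mem hT hsT]
    -- The frozen states are within `M * τ` of the polygons, so they share the limit.
    have h0 : Tendsto (fun k => X (σ k) s - z (σ k) s) atTop (𝓝 0) := by
      refine squeeze_zero_norm (fun k => hzX (σ k) s hs.1.le) ?_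
      have := (tendsto_one_div_add_atTop_nhds_zero_nat (𝕜 := ℝ)).comp hσ.tendsto_atTop
      simpa using this.const_mul M
    simpa using (hpt ⟨s, hsT⟩).sub h0

end Peano

/-! ### Trajectories on compact intervals: estimates and existence. -/

section Arcs

variable {n m : ℕ} {U : Set (EuclideanSpace ℝ (Fin m))} {G G₁ S : Set (EuclideanSpace ℝ (Fin n))}
  {f : EuclideanSpace ℝ (Fin n) → EuclideanSpace ℝ (Fin m) → EuclideanSpace ℝ (Fin n)}
  {p q : EuclideanSpace ℝ (Fin n)} {u : ℝ → EuclideanSpace ℝ (Fin m)}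
  {x y : ℝ → EuclideanSpace ℝ (Fin n)} {T : ℝ}

/-- Everywhere defined Borel controls with values in `U`. -/
def IsBorelControl (U : Set (EuclideanSpace ℝ (Fin m))) (u : ℝ → EuclideanSpace ℝ (Fin m)) : Prop :=
  Measurable u ∧ ∀ t, u t ∈ U

/-- The integral equation of `IsTrajectory` on an arbitrary set `I` of times. -/
def IsTrajectoryOn (f : EuclideanSpace ℝ (Fin n) → EuclideanSpace ℝ (Fin m) →
      EuclideanSpace ℝ (Fin n)) (S : Set (EuclideanSpace ℝ (Fin n))) (I : Set ℝ)
    (x₀ : EuclideanSpace ℝ (Fin n)) (u : ℝ → EuclideanSpace ℝ (Fin m))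
    (x : ℝ → EuclideanSpace ℝ (Fin n)) : Prop :=
  ∀ t ∈ I, x t ∈ S ∧ IntervalIntegrable (fun s => f (x s) (u s)) volume 0 t ∧
    x t = x₀ + ∫ s in (0 : ℝ)..t, f (x s) (u s)

theorem isTrajectoryOn_Ici_iff :
    IsTrajectoryOn f S (Ici 0) p u x ↔ IsTrajectory f S ⊤ p u x :=
  ⟨fun h t ht _ => h t ht, fun h t ht => h t ht (EReal.coe_lt_top t)⟩

theorem IsTrajectoryOn.mono {I J : Set ℝ} {S' : Set (EuclideanSpace ℝ (Fin n))}
    (h : IsTrajectoryOn f S I p u x) (hJ : J ⊆ I) (hS : ∀ t ∈ J, x t ∈ S → x t ∈ S') :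
    IsTrajectoryOn f S' J p u x :=
  fun t ht => ⟨hS t ht (h t (hJ ht)).1, (h t (hJ ht)).2⟩

theorem IsTrajectoryOn.apply_zero {I : Set ℝ} (h : IsTrajectoryOn f S I p u x) (h0 : (0 : ℝ) ∈ I) :
    x 0 = p := by
  simpa using (h 0 h0).2.2

theorem IsTrajectoryOn.continuousOn (h : IsTrajectoryOn f S (Icc 0 T) p u x) :
    ContinuousOn x (Icc 0 T) := by
  rcases lt_or_ge T 0 with hT | hT
  · simp [Icc_eq_empty hT.not_ge]
  have h1 : IntegrableOn (fun s => f (x s) (u s)) (uIcc 0 T) := by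
    have := (h T ⟨hT, le_rfl⟩).2.1
    rwa [intervalIntegrable_iff, uIoc_of_le hT, ← integrableOn_Icc_iff_integrableOn_Ioc,
      ← uIcc_of_le hT] at this
  have h2 := intervalIntegral.continuousOn_primitive_interval h1
  rw [uIcc_of_le hT] at h2
  exact (continuousOn_const.add h2).congr fun t ht => (h t ht).2.2

theorem IsTrajectoryOn.norm_sub_le {M : ℝ} (h : IsTrajectoryOn f S (Icc 0 T) p u x)
    (hM : ∀ z ∈ S, ∀ w ∈ U, ‖f z w‖ ≤ M) (hu : ∀ t, u t ∈ U) {t : ℝ} (ht : t ∈ Icc 0 T) :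
    ‖x t - p‖ ≤ M * t := by
  rw [(h t ht).2.2, add_sub_cancel_left]
  have := intervalIntegral.norm_integral_le_of_norm_le_const (a := 0) (b := t) (C := M)
    (f := fun s => f (x s) (u s)) fun s hs => by
      rw [uIoc_of_le ht.1] at hs
      exact hM _ (h s ⟨hs.1.le, hs.2.trans ht.2⟩).1 _ (hu s)
  rwa [sub_zero, abs_of_nonneg ht.1] at this

/-- Grönwall, applied to the differentiable majorant `‖p - q‖ + ∫ C ‖x - y‖`, since the distance
itself need not be differentiable. -/
theorem IsTrajectoryOn.norm_sub_le_exp {C : ℝ} (hx : IsTrajectoryOn f S (Icc 0 T) p u x)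
    (hy : IsTrajectoryOn f S (Icc 0 T) q u y) (hC : 0 ≤ C)
    (hlip : ∀ z ∈ S, ∀ z' ∈ S, ∀ w ∈ U, ‖f z w - f z' w‖ ≤ C * ‖z - z'‖) (hu : ∀ t, u t ∈ U)
    {t : ℝ} (ht : t ∈ Icc 0 T) : ‖x t - y t‖ ≤ ‖p - q‖ * Real.exp (C * t) := by
  have hT : 0 ≤ T := ht.1.trans ht.2
  -- Composing with `projIcc` makes the integrand continuous on all of `ℝ`, so its primitive is
  -- differentiable everywhere.
  set d : ℝ → ℝ := fun s => C * ‖x (projIcc 0 T hT s) - y (projIcc 0 T hT s)‖ with hd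
  have hproj : Continuous fun s => (projIcc 0 T hT s : ℝ) :=
    continuous_subtype_val.comp continuous_projIcc
  have hdc : Continuous d := by
    have h1 := hx.continuousOn.comp_continuous hproj fun s => (projIcc 0 T hT s).2
    have h2 := hy.continuousOn.comp_continuous hproj fun s => (projIcc 0 T hT s).2
    exact continuous_const.mul (h1.sub h2).norm
  have hdeq : ∀ s ∈ Icc 0 T, d s = C * ‖x s - y s‖ := fun s hs => by
    simp only [hd, projIcc_of_mem hT hs]
  set g : ℝ → ℝ := fun s => ‖p - q‖ + ∫ r in (0 : ℝ)..s, d r with hg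
  have hgd : ∀ s, HasDerivAt g (d s) s := fun s =>
    (intervalIntegral.integral_hasDerivAt_right (hdc.intervalIntegrable _ _)
      (hdc.stronglyMeasurableAtFilter _ _) hdc.continuousAt).const_add _
  have hle : ∀ s ∈ Icc 0 T, ‖x s - y s‖ ≤ g s := fun s hs => by
    have e : x s - y s = (p - q) + ∫ r in (0 : ℝ)..s, (f (x r) (u r) - f (y r) (u r)) := by
      rw [intervalIntegral.integral_sub (hx s hs).2.1 (hy s hs).2.1, (hx s hs).2.2, (hy s hs).2.2]
      abel
    rw [e]
    refine (norm_add_le _ _).trans (add_le_add_right ?_ _)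
    refine intervalIntegral.norm_integral_le_of_norm_le hs.1 (ae_of_all _ fun r hr => ?_)
      (hdc.intervalIntegrable _ _)
    have hr' : r ∈ Icc 0 T := ⟨hr.1.le, hr.2.trans hs.2⟩
    rw [hdeq r hr']
    exact hlip _ (hx r hr').1 _ (hy r hr').1 _ (hu r)
  have hg0 : ∀ s ∈ Icc 0 T, 0 ≤ g s := fun s hs => (norm_nonneg _).trans (hle s hs)
  have key := norm_le_gronwallBound_of_norm_deriv_right_le (f := g) (f' := d) (δ := ‖p - q‖)
    (K := C) (ε := 0) (a := 0) (b := T) (fun s _ => (hgd s).continuousAt.continuousWithinAt)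
    (fun s _ => (hgd s).hasDerivWithinAt) (by simp [hg]) (fun s hs => ?_) t ht
  · rw [gronwallBound_ε0, sub_zero] at key
    exact (hle t ht).trans ((le_abs_self _).trans key)
  · have hs' := Ico_subset_Icc_self hs
    rw [hdeq s hs', Real.norm_of_nonneg (hg0 s hs'), add_zero,
      Real.norm_of_nonneg (mul_nonneg hC (norm_nonneg _))]
    exact mul_le_mul_of_nonneg_left (hle s hs') hC

/-- Cut off `f` outside a compact set and extend it continuously to all controls. -/
theorem exists_boundedContinuous_cutoff {K : Set (EuclideanSpace ℝ (Fin n))} (hU : IsCompact U)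
    (hG₁ : IsOpen G₁) (hf : ContinuousOn (fun p : EuclideanSpace ℝ (Fin n) ×
      EuclideanSpace ℝ (Fin m) => f p.1 p.2) (G₁ ×ˢ U)) (hK : IsCompact K) (hKG : K ⊆ G₁) :
    ∃ (F : BoundedContinuousFunction (EuclideanSpace ℝ (Fin n) × EuclideanSpace ℝ (Fin m))
      (EuclideanSpace ℝ (Fin n))) (χ : EuclideanSpace ℝ (Fin n) → ℝ),
      (∀ z, χ z ∈ Icc (0 : ℝ) 1) ∧ (∀ z ∈ K, χ z = 1) ∧
      ∀ z, ∀ w ∈ U, F (z, w) = χ z • f z w := by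
  obtain ⟨L, hL, hKL, hLG⟩ := exists_compact_between hK hG₁ hKG
  obtain ⟨χ, hχ1, hχ0, -, hχ⟩ := exists_continuous_one_zero_of_isCompact hK
    (isOpen_interior (s := L)).isClosed_compl (disjoint_compl_right_iff_subset.2 hKL)
  set g : EuclideanSpace ℝ (Fin n) × EuclideanSpace ℝ (Fin m) → EuclideanSpace ℝ (Fin n) :=
    fun p => χ p.1 • f p.1 p.2 with hg
  have hgG : ContinuousOn g (G₁ ×ˢ U) :=
    (χ.continuous.comp continuous_fst).continuousOn.smul hf
  have hcl : closure (interior L) ⊆ L := closure_minimal interior_subset hL.isClosed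
  have hgc : ContinuousOn g (univ ×ˢ U) := by
    rintro ⟨z, w⟩ ⟨-, hw⟩
    by_cases hz : z ∈ L
    · have := hgG (z, w) ⟨hLG hz, hw⟩
      refine this.mono_of_mem_nhdsWithin ?_
      have : (G₁ ×ˢ (univ : Set (EuclideanSpace ℝ (Fin m)))) ∈ 𝓝 (z, w) :=
        (hG₁.prod isOpen_univ).mem_nhds ⟨hLG hz, trivial⟩
      filter_upwards [mem_nhdsWithin_of_mem_nhds this, self_mem_nhdsWithin] with r h1 h2
      exact ⟨h1.1, h2.2⟩
    · have h0 : (Lᶜ ×ˢ (univ : Set (EuclideanSpace ℝ (Fin m)))) ∈ 𝓝 (z, w) :=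
        (hL.isClosed.isOpen_compl.prod isOpen_univ).mem_nhds ⟨hz, trivial⟩
      have hzero : g =ᶠ[𝓝 (z, w)] fun _ => 0 := by
        filter_upwards [h0] with r hr
        have : χ r.1 = 0 := hχ0 fun h => hr.1 (interior_subset h)
        simp [hg, this]
      exact (continuousAt_const.congr hzero.symm).continuousWithinAt
  obtain ⟨M, hM⟩ := (hL.prod hU).exists_bound_of_continuousOn
    (hf.mono (prod_mono hLG le_rfl))
  have hbd : ∀ r ∈ (univ ×ˢ U : Set (EuclideanSpace ℝ (Fin n) × EuclideanSpace ℝ (Fin m))),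
      ‖g r‖ ≤ |M| := by
    rintro ⟨z, w⟩ ⟨-, hw⟩
    by_cases hz : z ∈ L
    · simp only [hg, norm_smul, Real.norm_of_nonneg (hχ z).1]
      calc χ z * ‖f z w‖ ≤ 1 * |M| := mul_le_mul (hχ z).2
            ((hM (z, w) ⟨hz, hw⟩).trans (le_abs_self M)) (norm_nonneg _) zero_le_one
        _ = |M| := one_mul _
    · have : χ z = 0 := hχ0 fun h => hz (interior_subset h)
      simp [hg, this]
  -- Tietze extension from the closed set `univ ×ˢ U`.
  obtain ⟨F, -, hF⟩ := BoundedContinuousFunction.exists_norm_eq_domRestrict_eq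
    (isClosed_univ.prod hU.isClosed) ℝ (BoundedContinuousFunction.ofNormedAddCommGroup
      ((univ ×ˢ U).domRestrict g) hgc.domRestrict |M| fun r => hbd r r.2)
  refine ⟨F, χ, hχ, fun z hz => hχ1 hz, fun z w hw => ?_⟩
  exact congrArg (fun φ => φ ⟨(z, w), ⟨trivial, hw⟩⟩) hF

/-- Grönwall estimate for an energy function along a Carathéodory solution. -/
theorem energy_le_exp {F : EuclideanSpace ℝ (Fin n) × EuclideanSpace ℝ (Fin m) →
      EuclideanSpace ℝ (Fin n)} (hF : Continuous F) {M : ℝ} (hM : ∀ r, ‖F r‖ ≤ M)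
    (hU : IsCompact U) {Y : EuclideanSpace ℝ (Fin n) → ℝ} {C : ℝ}
    (hY : ∀ z ∈ G₁, DifferentiableAt ℝ Y z)
    (hYF : ∀ z ∈ G₁, ∀ w ∈ U, fderiv ℝ Y z (F (z, w)) ≤ C * Y z)
    (hu : IsBorelControl U u) (hx : Continuous x)
    (hxe : ∀ t ∈ Icc 0 T, x t = p + ∫ s in (0 : ℝ)..t, F (x s, u s))
    (hxG : ∀ t ∈ Icc 0 T, x t ∈ G₁) :
    ∀ t ∈ Icc 0 T, Y (x t) ≤ Y p * Real.exp (C * t) := by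
  intro t₁ ht₁
  have hT : 0 ≤ T := ht₁.1.trans ht₁.2
  have hgm : Measurable fun s => F (x s, u s) := hF.measurable.comp (hx.measurable.prodMk hu.1)
  have hint := intervalIntegrable_of_measurable_of_norm_le hgm fun s => hM _
  have hx0 : x 0 = p := by simpa using hxe 0 ⟨le_rfl, hT⟩
  have key := le_gronwallBound_of_liminf_deriv_right_le (f := fun t => Y (x t))
    (f' := fun t => C * Y (x t)) (δ := Y p) (K := C) (ε := 0) (a := 0) (b := T)
    (fun t ht => ((hY _ (hxG t ht)).continuousAt.comp hx.continuousAt).continuousWithinAt)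
    ?_ (by rw [hx0]) (fun t _ => by simp) t₁ ht₁
  · rwa [gronwallBound_ε0, sub_zero] at key
  -- The control is only measurable, so `Y ∘ x` may fail to be differentiable; a bound on right
  -- difference quotients suffices. Compactness of `U` makes the directional bound uniform in the
  -- control value near `x t`.
  intro t ht r hr
  apply Eventually.frequently
  have htG := hxG t (Ico_subset_Icc_self ht)
  set D := fderiv ℝ Y (x t) with hD
  obtain ⟨r', hr'1, hr'2⟩ := exists_between hr
  have hM0 : 0 ≤ M := (norm_nonneg _).trans (hM (p, u 0))
  have hη : 0 < (r - r') / (M + 1) := div_pos (sub_pos.2 hr'2) (by linarith)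
  have hdir : ∀ᶠ z in 𝓝 (x t), ∀ w ∈ U, D (F (z, w)) < r' := by
    refine hU.eventually_forall_of_forall_eventually fun w hw => ?_
    have hc : Continuous fun a : EuclideanSpace ℝ (Fin n) × EuclideanSpace ℝ (Fin m) => D (F a) :=
      D.continuous.comp hF
    exact (hc.tendsto (x t, w)).eventually_lt_const ((hYF _ htG w hw).trans_lt hr'1)
  obtain ⟨δ, hδ, hball⟩ := Metric.eventually_nhds_iff.1 (hx.continuousAt.eventually hdir)
  have hlin := hx.continuousAt.eventually ((hY _ htG).hasFDerivAt.isLittleO.def hη)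
  filter_upwards [self_mem_nhdsWithin, mem_nhdsWithin_of_mem_nhds hlin,
    mem_nhdsWithin_of_mem_nhds (Metric.ball_mem_nhds t hδ),
    mem_nhdsWithin_of_mem_nhds (Iio_mem_nhds ht.2)] with z hz hzlin hzδ hzT
  have hz : t < z := hz
  have hzT : z < T := hzT
  have hdiff : x z - x t = ∫ s in t..z, F (x s, u s) := by
    rw [hxe z ⟨ht.1.trans hz.le, hzT.le⟩, hxe t (Ico_subset_Icc_self ht),
      add_sub_add_left_eq_sub, intervalIntegral.integral_interval_sub_left (hint _ _) (hint _ _)]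
  have h1 : D (x z - x t) ≤ r' * (z - t) := by
    rw [hdiff, ← ContinuousLinearMap.intervalIntegral_comp_comm _ (hint _ _)]
    have hcI : ∫ _s in t..z, r' = r' * (z - t) := by
      rw [intervalIntegral.integral_const, smul_eq_mul, mul_comm]
    rw [← hcI]
    refine intervalIntegral.integral_mono_on hz.le ?_ intervalIntegrable_const fun s hs => ?_
    · exact ⟨D.integrable_comp (hint t z).1, D.integrable_comp (hint t z).2⟩
    · refine (hball ?_ _ (hu.2 s)).le
      rw [Real.dist_eq, abs_of_nonneg (by linarith [hs.1])]
      rw [Metric.mem_ball, Real.dist_eq, abs_of_nonneg (by linarith)] at hzδ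
      linarith [hs.2]
  have h2 : ‖x z - x t‖ ≤ M * (z - t) := by
    rw [hdiff]
    have := intervalIntegral.norm_integral_le_of_norm_le_const (a := t) (b := z) (C := M)
      (f := fun s => F (x s, u s)) fun s _ => hM _
    rwa [abs_of_nonneg (by linarith)] at this
  have h3 : Y (x z) - Y (x t) - D (x z - x t) ≤ (r - r') / (M + 1) * (M * (z - t)) :=
    (le_abs_self _).trans (hzlin.trans (mul_le_mul_of_nonneg_left h2 hη.le))
  have h4 : (r - r') / (M + 1) * (M * (z - t)) < (r - r') * (z - t) := by
    rw [div_mul_eq_mul_div, div_lt_iff₀ (by linarith)]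
    have : 0 < (r - r') * (z - t) := mul_pos (by linarith) (by linarith)
    nlinarith
  rw [inv_mul_lt_iff₀ (by linarith)]
  nlinarith

theorem IsBorelControl.mem_admissibleControls (hU : IsCompact U) (hu : IsBorelControl U u) :
    u ∈ AdmissibleControls U := by
  refine ⟨fun T _ => ?_, fun t _ => hu.2 t⟩
  obtain ⟨M, hM⟩ := hU.isBounded.exists_norm_le
  exact memLp_top_of_bound hu.1.aestronglyMeasurable M (ae_of_all _ fun t => hM _ (hu.2 t))

/-- On a bounded horizon, trajectories from a compact subset of `G` exist and share a compact
subset of `closure G`. -/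
theorem SystemConditions.exists_trajectory (hsys : SystemConditions U G G₁ f)
    {K₀ : Set (EuclideanSpace ℝ (Fin n))} (hK₀ : IsCompact K₀) (hK₀G : K₀ ⊆ G) (T : ℝ) :
    ∃ K, IsCompact K ∧ K ⊆ closure G ∧ ∀ p ∈ K₀, ∀ u, IsBorelControl U u →
      ∃ x, IsTrajectoryOn f (G ∩ K) (Icc 0 T) p u x := by
  obtain ⟨Y, C, hC, hYd, hY0, hYp, hYf⟩ := hsys.growth
  have hGG₁ : G ⊆ G₁ := subset_closure.trans hsys.closure_G_subset
  have hYdiff : ∀ z ∈ G₁, DifferentiableAt ℝ Y z := fun z hz =>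
    (hYd.differentiableOn one_ne_zero).differentiableAt (hsys.open_G₁.mem_nhds hz)
  obtain ⟨B, hB⟩ := hK₀.exists_bound_of_continuousOn
    (hYd.continuousOn.mono (hK₀G.trans hGG₁))
  -- The Grönwall bound for `Y` over `[0, T + 1]`. The extra unit of time is for strong invariance,
  -- which is stated on half-open intervals while the endpoint `T` is needed.
  set L := G₁ ∩ Y ⁻¹' Icc 0 (B * Real.exp (C * (T + 1))) with hL
  have hLc : IsCompact L := hYp _ isCompact_Icc
  obtain ⟨F, χ, hχ, hχ1, hFχ⟩ := exists_boundedContinuous_cutoff hsys.compact_U hsys.open_G₁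
    hsys.continuous_f hLc inter_subset_left
  refine ⟨L ∩ closure G, hLc.inter_right isClosed_closure, inter_subset_right,
    fun p hp u hu => ?_⟩
  obtain ⟨x, hxc, hxe⟩ := exists_solution_of_bounded F.continuous (M := ‖F‖) F.norm_coe_le_norm
    hu.1 p (T + 1)
  rcases lt_or_ge T 0 with hT | hT
  · exact ⟨x, by simp [IsTrajectoryOn, Icc_eq_empty hT.not_ge]⟩
  have hpG : p ∈ G₁ := hGG₁ (hK₀G hp)
  have hx0 : x 0 = p := by simpa using hxe 0 ⟨le_rfl, by linarith⟩
  -- The growth inequality survives the cutoff because `0 ≤ χ ≤ 1` and `C * Y z ≥ 0`.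
  have hYF : ∀ z ∈ G₁, ∀ w ∈ U, fderiv ℝ Y z (F (z, w)) ≤ C * Y z := fun z hz w hw => by
    rw [hFχ z w hw, map_smul, smul_eq_mul]
    have h1 := mul_le_mul_of_nonneg_left (hYf z hz w hw) (hχ z).1
    have h2 := mul_le_mul_of_nonneg_right (hχ z).2 (mul_nonneg hC.le (hY0 z hz))
    linarith
  have hxL : ∀ s, s ≤ T + 1 → (∀ t ∈ Icc 0 s, x t ∈ G₁) → ∀ t ∈ Icc 0 s, x t ∈ L := by
    intro s hs hsG t ht
    refine ⟨hsG t ht, hY0 _ (hsG t ht), ?_⟩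
    have h1 := energy_le_exp F.continuous F.norm_coe_le_norm hsys.compact_U hYdiff hYF hu hxc
      (fun t ht => hxe t ⟨ht.1, ht.2.trans hs⟩) hsG t ht
    have h2 : Y p ≤ B := (le_abs_self _).trans (hB p hp)
    refine h1.trans (mul_le_mul h2 (Real.exp_le_exp.2 ?_) (Real.exp_pos _).le ?_)
    · exact mul_le_mul_of_nonneg_left (ht.2.trans hs) hC.le
    · exact (hY0 p hpG).trans h2
  -- At a first exit time from `G₁` the state would be a limit of points of the compact set `L ⊆
  -- G₁`.
  have hxG : ∀ t ∈ Icc 0 (T + 1), x t ∈ G₁ := by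
    by_contra! hne
    set Z := Icc 0 (T + 1) ∩ x ⁻¹' G₁ᶜ with hZ
    have hZc : IsClosed Z := isClosed_Icc.inter (hsys.open_G₁.isClosed_compl.preimage hxc)
    have hZb : BddBelow Z := ⟨0, fun t ht => ht.1.1⟩
    have ht₀ : sInf Z ∈ Z := hZc.csInf_mem hne hZb
    set t₀ := sInf Z
    have hpos : 0 < t₀ := lt_of_le_of_ne ht₀.1.1 fun h => ht₀.2 (by rw [← h, hx0]; exact hpG)
    have hbefore : ∀ t ∈ Ico 0 t₀, x t ∈ L := fun t ht => by
      refine hxL t (ht.2.le.trans ht₀.1.2) (fun s hs => ?_) t ⟨ht.1, le_rfl⟩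
      by_contra hsG
      exact (csInf_le hZb ⟨⟨hs.1, (hs.2.trans ht.2.le).trans ht₀.1.2⟩, hsG⟩).not_gt
        (hs.2.trans_lt ht.2)
    have hcl : x t₀ ∈ closure L := by
      refine map_mem_closure hxc ?_ hbefore
      rw [closure_Ico hpos.ne]
      exact ⟨hpos.le, le_rfl⟩
    rw [hLc.isClosed.closure_eq] at hcl
    exact ht₀.2 hcl.1
  have hL' := hxL (T + 1) le_rfl hxG
  have hgm : Measurable fun s => F (x s, u s) :=
    F.continuous.measurable.comp (hxc.measurable.prodMk hu.1)
  have htraj : IsTrajectoryOn f G₁ (Icc 0 (T + 1)) p u x := by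
    intro t ht
    have heq : EqOn (fun s => F (x s, u s)) (fun s => f (x s) (u s)) (uIcc 0 t) := fun s hs => by
      rw [uIcc_of_le ht.1] at hs
      simp only [hFχ _ _ (hu.2 s), hχ1 _ (hL' s ⟨hs.1, hs.2.trans ht.2⟩), one_smul]
    refine ⟨hxG t ht, ?_, ?_⟩
    · exact (intervalIntegrable_of_measurable_of_norm_le hgm
        (fun s => F.norm_coe_le_norm _) 0 t).congr (heq.mono uIoc_subset_uIcc)
    · rw [hxe t ht, intervalIntegral.integral_congr heq]
  refine ⟨x, htraj.mono (Icc_subset_Icc_right (by linarith)) fun t ht _ => ?_⟩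
  have hG : x t ∈ G := hsys.strongly_invariant ((T + 1 : ℝ) : EReal)
    (by exact_mod_cast (by linarith : (0 : ℝ) < T + 1)) p (hK₀G hp) u
    (hu.mem_admissibleControls hsys.compact_U) x
    (fun s hs hsT => htraj s ⟨hs, (EReal.coe_lt_coe_iff.1 hsT).le⟩) t ht.1
    (EReal.coe_lt_coe_iff.2 (by linarith [ht.2]))
  exact ⟨hG, hL' t ⟨ht.1, by linarith [ht.2]⟩, subset_closure hG⟩

theorem SystemConditions.exists_bound_lipschitz (hsys : SystemConditions U G G₁ f)
    {K : Set (EuclideanSpace ℝ (Fin n))} (hK : IsCompact K) (hKG : K ⊆ closure G) :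
    ∃ M C : ℝ, 0 < M ∧ 0 < C ∧ (∀ z ∈ K, ∀ w ∈ U, ‖f z w‖ ≤ M) ∧
      ∀ z ∈ K, ∀ z' ∈ K, ∀ w ∈ U, ‖f z w - f z' w‖ ≤ C * ‖z - z'‖ := by
  obtain ⟨M, hM⟩ := (hK.prod hsys.compact_U).exists_bound_of_continuousOn
    (hsys.continuous_f.mono (prod_mono (hKG.trans hsys.closure_G_subset) le_rfl))
  obtain ⟨R, hR, hKR⟩ := hK.isBounded.subset_closedBall_lt 0 0
  obtain ⟨C, hC, hlip⟩ := hsys.lipschitz_f R hR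
  refine ⟨|M| + 1, C, by positivity, hC, fun z hz w hw => ?_, fun z hz z' hz' w hw =>
    hlip z ⟨hKR hz, hKG hz⟩ z' ⟨hKR hz', hKG hz'⟩ w hw⟩
  exact (hM (z, w) ⟨hz, hw⟩).trans ((le_abs_self M).trans (by linarith))

end Arcs

/-! ### Borel representatives of controls, time shifts and gluing of arcs. -/

section Concatenation

variable {n m : ℕ} {U : Set (EuclideanSpace ℝ (Fin m))} {G S : Set (EuclideanSpace ℝ (Fin n))}
  {f : EuclideanSpace ℝ (Fin n) → EuclideanSpace ℝ (Fin m) → EuclideanSpace ℝ (Fin n)}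
  {p q r : EuclideanSpace ℝ (Fin n)} {u v : ℝ → EuclideanSpace ℝ (Fin m)}
  {x y : ℝ → EuclideanSpace ℝ (Fin n)} {T T' : ℝ}

/-- A measurable representative on `[0, ∞)` is reset to `u 0` wherever it leaves the closed set `U`.
-/
theorem exists_isBorelControl_ae_eq (hU : IsCompact U) (hu : u ∈ AdmissibleControls U) :
    ∃ v, IsBorelControl U v ∧ ∀ᵐ t, 0 ≤ t → v t = u t := by
  have hcover : (⋃ k : ℕ, Icc (0 : ℝ) (k + 1)) = Ici 0 := by
    ext t
    simp only [mem_iUnion, mem_Icc, mem_Ici]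
    refine ⟨fun ⟨_, h⟩ => h.1, fun h => ⟨⌊t⌋₊, h, (Nat.lt_floor_add_one t).le⟩⟩
  have hae : AEStronglyMeasurable u (volume.restrict (Ici 0)) := by
    rw [← hcover, aestronglyMeasurable_iUnion_iff]
    exact fun k => (hu.1 (k + 1) (by positivity)).1
  have hm := hae.stronglyMeasurable_mk.measurable
  have hset : MeasurableSet (hae.mk u ⁻¹' U) := hm hU.isClosed.measurableSet
  classical
  refine ⟨(hae.mk u ⁻¹' U).piecewise (hae.mk u) fun _ => u 0,
    ⟨hm.piecewise hset measurable_const, fun t => ?_⟩, ?_⟩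
  · by_cases ht : t ∈ hae.mk u ⁻¹' U
    · rw [piecewise_eq_of_mem _ _ _ ht]; exact ht
    · rw [piecewise_eq_of_notMem _ _ _ ht]; exact hu.2 0 le_rfl
  · filter_upwards [(ae_restrict_iff' measurableSet_Ici).1 hae.ae_eq_mk] with t ht h0
    have ht := ht h0
    have : t ∈ hae.mk u ⁻¹' U := by
      rw [mem_preimage, ← ht]
      exact hu.2 t h0
    rw [piecewise_eq_of_mem _ _ _ this, ← ht]

theorem IsTrajectoryOn.congr_control {I : Set ℝ} (hx : IsTrajectoryOn f S I p u x)
    (hI : I ⊆ Ici 0) (huv : ∀ᵐ t, 0 ≤ t → v t = u t) : IsTrajectoryOn f S I p v x := by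
  intro t ht
  obtain ⟨h1, h2, h3⟩ := hx t ht
  have hae : ∀ᵐ s, s ∈ uIoc 0 t → f (x s) (u s) = f (x s) (v s) := by
    filter_upwards [huv] with s hs hmem
    rw [uIoc_of_le (hI ht)] at hmem
    rw [hs hmem.1.le]
  refine ⟨h1, h2.congr_ae ((ae_restrict_iff' measurableSet_uIoc).2 hae), ?_⟩
  rw [h3, intervalIntegral.integral_congr_ae hae]

theorem mem_nullControllabilityRegion_iff (hU : IsCompact U) :
    p ∈ nullControllabilityRegion U G f ↔
      ∃ u, IsBorelControl U u ∧ ∃ x, IsTrajectoryOn f G (Ici 0) p u x ∧ Tendsto x atTop (𝓝 0) := by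
  constructor
  · rintro ⟨-, u, hu, x, hx, hlim⟩
    obtain ⟨v, hv, hvu⟩ := exists_isBorelControl_ae_eq hU hu
    exact ⟨v, hv, x, (isTrajectoryOn_Ici_iff.2 hx).congr_control le_rfl hvu,
      tendsto_zero_iff_norm_tendsto_zero.2 hlim⟩
  · rintro ⟨u, hu, x, hx, hlim⟩
    refine ⟨?_, u, hu.mem_admissibleControls hU, x, isTrajectoryOn_Ici_iff.1 hx,
      tendsto_zero_iff_norm_tendsto_zero.1 hlim⟩
    rw [← hx.apply_zero self_mem_Ici]
    exact (hx 0 self_mem_Ici).1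

/-- Follow `a` up to time `T`, then `b` with its clock started at `T`. -/
noncomputable def concatAt {α : Type*} (T : ℝ) (a b : ℝ → α) : ℝ → α :=
  fun t => if t ≤ T then a t else b (t - T)

theorem concatAt_of_le {α : Type*} {a b : ℝ → α} {t : ℝ} (h : t ≤ T) : concatAt T a b t = a t :=
  if_pos h

theorem concatAt_of_lt {α : Type*} {a b : ℝ → α} {t : ℝ} (h : T < t) :
    concatAt T a b t = b (t - T) :=
  if_neg h.not_ge

theorem IsBorelControl.concatAt (hu : IsBorelControl U u) (hv : IsBorelControl U v) (T : ℝ) :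
    IsBorelControl U (concatAt T u v) := by
  refine ⟨Measurable.ite measurableSet_Iic hu.1 (hv.1.comp (measurable_id.sub_const T)),
    fun t => ?_⟩
  rcases le_or_gt t T with h | h
  · rw [concatAt_of_le h]; exact hu.2 t
  · rw [concatAt_of_lt h]; exact hv.2 _

theorem IsBorelControl.comp_add (hu : IsBorelControl U u) (T : ℝ) :
    IsBorelControl U fun t => u (t + T) :=
  ⟨hu.1.comp (measurable_id.add_const T), fun _ => hu.2 _⟩

theorem IsTrajectoryOn.concatAt {I J : Set ℝ} (hT : 0 ≤ T)
    (hx : IsTrajectoryOn f S (Icc 0 T) p u x) (hy : IsTrajectoryOn f S I (x T) v y)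
    (hJ : ∀ t ∈ J, 0 ≤ t ∧ (t ≤ T ∨ t - T ∈ I)) :
    IsTrajectoryOn f S J p (concatAt T u v) (concatAt T x y) := by
  set g := fun s => f (_root_.concatAt T x y s) (_root_.concatAt T u v s) with hg
  have hfst : ∀ t, t ≤ T → 0 ≤ t → EqOn (fun s => f (x s) (u s)) g (uIoc 0 t) := by
    intro t ht h0 s hs
    rw [uIoc_of_le h0] at hs
    simp only [hg, concatAt_of_le (hs.2.trans ht)]
  have hone : ∀ t, t ≤ T → 0 ≤ t → IntervalIntegrable g volume 0 t ∧
      x t = p + ∫ s in (0 : ℝ)..t, g s := by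
    intro t ht h0
    obtain ⟨-, h2, h3⟩ := hx t ⟨h0, ht⟩
    refine ⟨h2.congr (hfst t ht h0), ?_⟩
    rw [h3, intervalIntegral.integral_congr_ae (ae_of_all _ (hfst t ht h0))]
  intro t ht
  obtain ⟨h0, hI⟩ := hJ t ht
  rcases le_or_gt t T with h | h
  · rw [concatAt_of_le h]
    exact ⟨(hx t ⟨h0, h⟩).1, hone t h h0⟩
  · rw [concatAt_of_lt h]
    obtain ⟨h1, h2, h3⟩ := hy (t - T) (hI.resolve_left h.not_ge)
    have hsnd : EqOn (fun s => f (y (s - T)) (v (s - T))) g (uIoc T t) := by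
      intro s hs
      rw [uIoc_of_le h.le] at hs
      simp only [hg, concatAt_of_lt hs.1]
    have hint : IntervalIntegrable g volume T t := by
      have := h2.comp_sub_right T
      rw [zero_add, sub_add_cancel] at this
      exact this.congr hsnd
    obtain ⟨hT1, hT2⟩ := hone T le_rfl hT
    refine ⟨h1, hT1.trans hint, ?_⟩
    rw [h3, ← intervalIntegral.integral_add_adjacent_intervals hT1 hint, ← add_assoc, ← hT2,
      ← intervalIntegral.integral_congr_ae (ae_of_all _ hsnd),
      intervalIntegral.integral_comp_sub_right (fun s => f (y s) (v s)) T, sub_self]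

theorem IsTrajectoryOn.comp_add (hx : IsTrajectoryOn f S (Ici 0) p u x) (hT : 0 ≤ T) :
    IsTrajectoryOn f S (Ici 0) (x T) (fun t => u (t + T)) fun t => x (t + T) := by
  intro t ht
  have ht' : 0 ≤ t := ht
  obtain ⟨h1, h2, h3⟩ := hx (t + T) (add_nonneg ht' hT)
  obtain ⟨-, h2', h3'⟩ := hx T hT
  have hint := h2'.symm.trans h2
  refine ⟨h1, ?_, ?_⟩
  · have := hint.comp_add_right T
    rwa [sub_self, add_sub_cancel_right] at this
  · rw [intervalIntegral.integral_comp_add_right (fun s => f (x s) (u s)) T, zero_add]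
    simp only
    rw [h3, h3', ← intervalIntegral.integral_add_adjacent_intervals h2' hint, add_assoc]

/-- `q` is reached from `p` at time `T` along a trajectory in `S`. -/
def Reaches (U : Set (EuclideanSpace ℝ (Fin m))) (f : EuclideanSpace ℝ (Fin n) →
      EuclideanSpace ℝ (Fin m) → EuclideanSpace ℝ (Fin n)) (S : Set (EuclideanSpace ℝ (Fin n)))
    (T : ℝ) (p q : EuclideanSpace ℝ (Fin n)) : Prop :=
  0 ≤ T ∧ ∃ u, IsBorelControl U u ∧ ∃ x, IsTrajectoryOn f S (Icc 0 T) p u x ∧ x T = q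

theorem Reaches.trans (h : Reaches U f S T p q) (h' : Reaches U f S T' q r) :
    Reaches U f S (T + T') p r := by
  obtain ⟨hT, u, hu, x, hx, rfl⟩ := h
  obtain ⟨hT', v, hv, y, hy, rfl⟩ := h'
  refine ⟨add_nonneg hT hT', concatAt T u v, hu.concatAt hv T, concatAt T x y,
    hx.concatAt hT hy fun t ht => ⟨ht.1, ?_⟩, ?_⟩
  · rcases le_or_gt t T with h | h
    · exact Or.inl h
    · exact Or.inr ⟨by linarith, by linarith [ht.2]⟩
  · rcases hT'.eq_or_lt with rfl | h
    · rw [concatAt_of_le (by simp), add_zero, hy.apply_zero ⟨le_rfl, le_rfl⟩]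
    · rw [concatAt_of_lt (by linarith), add_sub_cancel_left]

/-- Prefixing a finite arc does not affect the limit at infinity. -/
theorem Reaches.mem_nullControllabilityRegion (hU : IsCompact U) (h : Reaches U f G T p q)
    (hq : q ∈ nullControllabilityRegion U G f) : p ∈ nullControllabilityRegion U G f := by
  rw [mem_nullControllabilityRegion_iff hU] at hq ⊢
  obtain ⟨hT, u, hu, x, hx, rfl⟩ := h
  obtain ⟨v, hv, y, hy, hlim⟩ := hq
  refine ⟨concatAt T u v, hu.concatAt hv T, concatAt T x y, hx.concatAt hT hy fun t ht =>
    ⟨ht, (le_or_gt t T).imp_right fun h => ?_⟩, ?_⟩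
  · exact sub_nonneg.2 h.le
  · refine (hlim.comp (tendsto_atTop_add_const_right _ (-T) tendsto_id)).congr' ?_
    filter_upwards [eventually_gt_atTop T] with t ht
    rw [concatAt_of_lt ht, sub_eq_add_neg]
    rfl

/-- Successive concatenation of a sequence of arcs, the `k`-th one lasting `τ k`. -/
noncomputable def iterConcat {α : Type*} (τ : ℕ → ℝ) (a : ℕ → ℝ → α) : ℕ → ℝ → α
  | 0 => a 0
  | k + 1 => concatAt (∑ j ∈ Finset.range k, τ j) (iterConcat τ a k) (a k)

theorem iterConcat_eq_of_le {α : Type*} {τ : ℕ → ℝ} (hτ : ∀ k, 0 ≤ τ k) (a : ℕ → ℝ → α) {j k : ℕ}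
    {t : ℝ} (hj : t ≤ ∑ i ∈ Finset.range j, τ i) (hk : t ≤ ∑ i ∈ Finset.range k, τ i) :
    iterConcat τ a j t = iterConcat τ a k t := by
  wlog h : j ≤ k generalizing j k
  · exact (this hk hj (le_of_not_ge h)).symm
  clear hk
  induction k, h using Nat.le_induction with
  | base => rfl
  | succ k hjk ih =>
    have hmono := Finset.sum_le_sum_of_subset_of_nonneg (Finset.range_mono hjk)
      fun i _ _ => hτ i
    rw [iterConcat, concatAt_of_le (hj.trans hmono), ih]

/-- Infinitely many arcs of duration at least one concatenate to a trajectory on `[0, ∞)`. -/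
theorem exists_trajectory_of_reaches {S : ℕ → Set (EuclideanSpace ℝ (Fin n))} (hS : Antitone S)
    {τ : ℕ → ℝ} (hτ : ∀ k, 1 ≤ τ k) {p : ℕ → EuclideanSpace ℝ (Fin n)}
    (h : ∀ k, Reaches U f (S k) (τ k) (p k) (p (k + 1))) :
    ∃ u, IsBorelControl U u ∧ ∃ x, IsTrajectoryOn f (S 0) (Ici 0) (p 0) u x ∧
      ∀ k, ∀ᶠ t in atTop, x t ∈ S k := by
  have hτ0 : ∀ k, 0 ≤ τ k := fun k => (h k).1
  choose v hv y hy hyp using fun k => (h k).2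
  set σ : ℕ → ℝ := fun k => ∑ i ∈ Finset.range k, τ i with hσ
  have hσs : ∀ k, σ (k + 1) = σ k + τ k := fun k => Finset.sum_range_succ _ _
  have hσ0 : ∀ k, 0 ≤ σ k := fun k => Finset.sum_nonneg fun i _ => hτ0 i
  have hσk : ∀ k : ℕ, (k : ℝ) ≤ σ k := fun k => by
    induction k with
    | zero => simp [hσ]
    | succ k ih => rw [hσs]; push_cast; linarith [hτ k]
  have hσfl : ∀ t : ℝ, t ≤ σ (⌊t⌋₊ + 1) := fun t =>
    (Nat.lt_floor_add_one t).le.trans (by exact_mod_cast hσk (⌊t⌋₊ + 1))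
  have hy0 : ∀ k, y k 0 = p k := fun k => (hy k).apply_zero ⟨le_rfl, hτ0 k⟩
  have hw : ∀ k, IsBorelControl U (iterConcat τ v k) := fun k => by
    induction k with
    | zero => exact hv 0
    | succ k ih => exact ih.concatAt (hv k) _
  -- Stage `k` has run arcs `0, …, k - 1`, of total length `σ k`; arc `k` enters at stage `k + 1`.
  have htraj : ∀ k, IsTrajectoryOn f (S 0) (Icc 0 (σ k)) (p 0) (iterConcat τ v k)
      (iterConcat τ y k) ∧ iterConcat τ y k (σ k) = p k := fun k => by
    induction k with
    | zero =>
      have : σ 0 = 0 := by simp [hσ]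
      rw [this]
      exact ⟨(hy 0).mono (Icc_subset_Icc_right (hτ0 0)) fun _ _ => id, hy0 0⟩
    | succ k ih =>
      have hyk : IsTrajectoryOn f (S 0) (Icc 0 (τ k)) (iterConcat τ y k (σ k)) (v k) (y k) := by
        rw [ih.2]
        exact (hy k).mono le_rfl fun t _ ht => hS (Nat.zero_le k) ht
      refine ⟨ih.1.concatAt (hσ0 k) hyk fun t ht => ⟨ht.1, ?_⟩, ?_⟩
      · refine (le_or_gt t (σ k)).imp_right fun h => ⟨by linarith, ?_⟩
        linarith [ht.2, hσs k]
      · have : σ k < σ (k + 1) := by linarith [hσs k, hτ k]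
        rw [iterConcat, concatAt_of_lt this, hσs, ← hyp k]
        congr 1
        exact add_sub_cancel_left _ _
  have htail : ∀ k j, k ≤ j → ∀ t ∈ Ioc (σ k) (σ j), iterConcat τ y j t ∈ S k := by
    intro k j hkj
    induction j, hkj using Nat.le_induction with
    | base => simp
    | succ j hkj ih =>
      intro t ht
      rcases le_or_gt t (σ j) with h | h
      · rw [iterConcat, concatAt_of_le h]
        exact ih t ⟨ht.1, h⟩
      · rw [iterConcat, concatAt_of_lt h]
        exact hS hkj (hy j _ ⟨sub_nonneg.2 h.le, sub_le_iff_le_add'.2 ((hσs j) ▸ ht.2)⟩).1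
  -- Durations are at least one, so stage `⌊t⌋₊ + 1` already covers time `t`. Later stages agree
  -- there, so the diagonal control is a pointwise limit of Borel controls.
  refine ⟨fun t => iterConcat τ v (⌊t⌋₊ + 1) t, ⟨?_, fun t => (hw _).2 t⟩,
    fun t => iterConcat τ y (⌊t⌋₊ + 1) t, fun t ht => ?_, fun k => ?_⟩
  · refine measurable_of_tendsto_metrizable (fun k => (hw k).1) (tendsto_pi_nhds.2 fun t => ?_)
    refine tendsto_const_nhds.congr' ?_
    filter_upwards [eventually_ge_atTop (⌊t⌋₊ + 1)] with k hk
    refine iterConcat_eq_of_le hτ0 v (hσfl t) ((hσfl t).trans ?_)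
    exact Finset.sum_le_sum_of_subset_of_nonneg (Finset.range_mono hk) fun i _ _ => hτ0 i
  · obtain ⟨h1, h2, h3⟩ := (htraj (⌊t⌋₊ + 1)).1 t ⟨ht, hσfl t⟩
    have heq : EqOn (fun s => f (iterConcat τ y (⌊t⌋₊ + 1) s) (iterConcat τ v (⌊t⌋₊ + 1) s))
        (fun s => f (iterConcat τ y (⌊s⌋₊ + 1) s) (iterConcat τ v (⌊s⌋₊ + 1) s)) (uIoc 0 t) := by
      intro s hs
      rw [uIoc_of_le ht] at hs
      have hst := hs.2.trans (hσfl t)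
      simp only [iterConcat_eq_of_le hτ0 _ hst (hσfl s)]
    refine ⟨h1, h2.congr heq, ?_⟩
    rw [← intervalIntegral.integral_congr_ae (ae_of_all _ heq)]
    exact h3
  · filter_upwards [eventually_gt_atTop (σ k)] with t ht
    have hk : t ≤ σ (max k (⌊t⌋₊ + 1)) := (hσfl t).trans
      (Finset.sum_le_sum_of_subset_of_nonneg (Finset.range_mono (le_max_right _ _))
        fun i _ _ => hτ0 i)
    rw [iterConcat_eq_of_le hτ0 y (hσfl t) hk]
    exact htail k _ (le_max_left _ _) t ⟨ht, hk⟩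

end Concatenation

/-! ### Steering the sublevel set of `V` to the origin. -/

section Lyapunov

variable {n m : ℕ} {U : Set (EuclideanSpace ℝ (Fin m))} {G G₁ Ω : Set (EuclideanSpace ℝ (Fin n))}
  {f : EuclideanSpace ℝ (Fin n) → EuclideanSpace ℝ (Fin m) → EuclideanSpace ℝ (Fin n)}
  {V : EuclideanSpace ℝ (Fin n) → ℝ} {c ε : ℝ} {p : EuclideanSpace ℝ (Fin n)}

theorem Reaches.refl {S : Set (EuclideanSpace ℝ (Fin n))} (hU : U.Nonempty) (hp : p ∈ S) :
    Reaches U f S 0 p p := by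
  obtain ⟨w, hw⟩ := hU
  refine ⟨le_rfl, fun _ => w, ⟨measurable_const, fun _ => hw⟩, fun _ => p, fun t ht => ?_, rfl⟩
  obtain rfl : t = 0 := le_antisymm ht.2 ht.1
  simp [hp]

/-- An infimum over no controls is `⊤`, which the decrease condition at `0` excludes. -/
theorem LocalCLFConditions.controls_nonempty (hV : LocalCLFConditions U G f Ω V c) :
    U.Nonempty := by
  obtain ⟨W, -, -, hW⟩ := hV.decrease
  by_contra h
  have := hW 0 hV.zero_mem
  rw [not_nonempty_iff_eq_empty.1 h] at this
  simp at this

theorem LocalCLFConditions.sublevel_subset (hV : LocalCLFConditions U G f Ω V c) (hε : ε ≤ c) :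
    {x ∈ closure Ω | V x ≤ ε} ⊆ Ω := by
  obtain ⟨C₃, hC₃, h⟩ := hV.sublevel_add_ball
  intro x hx
  exact h ⟨x, ⟨hx.1, hx.2.trans hε⟩, 0, Metric.mem_ball_self hC₃, add_zero x⟩

theorem LocalCLFConditions.nonneg (hV : LocalCLFConditions U G f Ω V c) {x}
    (hx : x ∈ closure Ω) : 0 ≤ V x := by
  rcases eq_or_ne x 0 with rfl | h
  · exact hV.posDef_V.1.ge
  · exact (hV.posDef_V.2 x hx h).le

theorem LocalCLFConditions.isCompact_sublevel (hV : LocalCLFConditions U G f Ω V c) (ε : ℝ) :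
    IsCompact {x ∈ closure Ω | V x ≤ ε} := by
  convert hV.proper_V (Icc 0 ε) isCompact_Icc using 1
  ext x
  exact ⟨fun h => ⟨h.1, hV.nonneg h.1, h.2⟩, fun h => ⟨h.1, h.2.2⟩⟩

theorem LocalCLFConditions.continuousAt (hV : LocalCLFConditions U G f Ω V c) {x} (hx : x ∈ Ω) :
    ContinuousAt V x :=
  (hV.continuous_V.mono subset_closure).continuousAt (hV.open_Ω.mem_nhds hx)

theorem LocalCLFConditions.isOpen_lt (hV : LocalCLFConditions U G f Ω V c) (a : ℝ) :
    IsOpen {x ∈ Ω | V x < a} :=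
  (hV.continuous_V.mono subset_closure).isOpen_inter_preimage hV.open_Ω isOpen_Iio

/-- The Dini condition yields a constant control that decreases `V` at an arbitrarily small
positive time. -/
theorem LocalCLFConditions.exists_control_decrease (hV : LocalCLFConditions U G f Ω V c)
    {K : Set (EuclideanSpace ℝ (Fin n))} {M C : ℝ} (hM0 : 0 < M) (hC : 0 < C)
    (hM : ∀ z ∈ K, ∀ w ∈ U, ‖f z w‖ ≤ M)
    (hlip : ∀ z ∈ K, ∀ z' ∈ K, ∀ w ∈ U, ‖f z w - f z' w‖ ≤ C * ‖z - z'‖)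
    (hp : p ∈ Ω) (hpK : p ∈ K) (hp0 : p ≠ 0) {δ : ℝ} (hδ : 0 < δ) :
    ∃ w ∈ U, ∃ h ∈ Ioo 0 δ, ∀ T, h ≤ T → ∀ x,
      IsTrajectoryOn f K (Icc 0 T) p (fun _ => w) x → V (x h) < V p := by
  obtain ⟨W, -, hWpos, hW⟩ := hV.decrease
  have hWp : 0 < W p := hWpos.2 p hp hp0
  have hlt : (⨅ u ∈ U, lowerDini V p (f p u)) < ((-(W p / 2) : ℝ) : EReal) :=
    (hW p hp).trans_lt (EReal.coe_lt_coe_iff.2 (by linarith))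
  obtain ⟨w, hlt⟩ := iInf_lt_iff.1 hlt
  obtain ⟨hw, hlt⟩ := iInf_lt_iff.1 hlt
  have hfreq := frequently_lt_of_liminf_lt (by isBoundedDefault) hlt
  obtain ⟨L, s, hs, hL⟩ := hV.locallyLipschitz_V hp
  rw [hV.open_Ω.nhdsWithin_eq hp] at hs
  obtain ⟨ρ, hρ, hball⟩ := Metric.mem_nhds_iff.1 hs
  have hL0 : (0 : ℝ) ≤ L := L.2
  -- The trajectory misses the Dini test point `p + h • v` by at most `2 * η * h`. This changes `V`
  -- by less than `h * W p / 2`, while the Dini quotient is below `-W p / 2`.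
  set η : ℝ := W p / (4 * (L + 1)) with hη
  have hη0 : 0 < η := by positivity
  have hLη : 2 * L * η < W p / 2 := by
    rw [hη, mul_div_assoc', div_lt_div_iff₀ (by positivity) (by positivity)]
    nlinarith
  have hsmall : ∀ a b : ℝ, 0 < b → ∀ᶠ h in 𝓝[>] (0 : ℝ), h * a < b := fun a b hb => by
    have : Tendsto (fun h : ℝ => h * a) (𝓝 0) (𝓝 0) := by
      simpa using (continuous_mul_const a).tendsto 0
    exact mem_nhdsWithin_of_mem_nhds (this.eventually_lt_const hb)
  have hev : ∀ᶠ r in 𝓝[>] (0 : ℝ) ×ˢ 𝓝 (f p w), (0 < r.1 ∧ r.1 * 1 < δ ∧ r.1 * (C * M) < η ∧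
      r.1 * (M + η) < ρ) ∧ dist r.2 (f p w) < η :=
    Eventually.prod_mk (((eventually_mem_nhdsWithin (a := (0 : ℝ)) (s := Ioi 0)).and
      ((hsmall 1 δ hδ).and ((hsmall (C * M) η hη0).and (hsmall (M + η) ρ hρ)))))
      (Metric.ball_mem_nhds _ hη0)
  obtain ⟨⟨h, v⟩, hdini, ⟨hh, hhδ, hhC, hhρ⟩, hv⟩ := (hfreq.and_eventually hev).exists
  simp only [mul_one] at hhδ hhC hhρ hh hv hdini
  refine ⟨w, hw, h, ⟨hh, hhδ⟩, fun T hT x hx => ?_⟩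
  rw [EReal.coe_lt_coe_iff, div_lt_iff₀ hh] at hdini
  rw [dist_eq_norm] at hv
  have hxK : ∀ s ∈ Icc 0 h, ‖x s - p‖ ≤ M * s := fun s hs =>
    hx.norm_sub_le hM (fun _ => hw) ⟨hs.1, hs.2.trans hT⟩
  have hxh : ‖x h - p - h • f p w‖ ≤ η * h := by
    obtain ⟨-, h2, h3⟩ := hx h ⟨hh.le, hT⟩
    have e : x h - p - h • f p w = ∫ s in (0 : ℝ)..h, (f (x s) w - f p w) := by
      rw [intervalIntegral.integral_sub h2 intervalIntegrable_const,
        intervalIntegral.integral_const, h3, sub_zero]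
      abel
    rw [e]
    have := intervalIntegral.norm_integral_le_of_norm_le_const (a := 0) (b := h) (C := η)
      (f := fun s => f (x s) w - f p w) fun s hs => by
        rw [uIoc_of_le hh.le] at hs
        have h1 := hlip _ (hx s ⟨hs.1.le, hs.2.trans hT⟩).1 _ hpK w hw
        have h2 := hxK s ⟨hs.1.le, hs.2⟩
        have h3 : M * s ≤ M * h := mul_le_mul_of_nonneg_left hs.2 hM0.le
        have h4 := mul_le_mul_of_nonneg_left (h2.trans h3) hC.le
        linarith
    rwa [sub_zero, abs_of_nonneg hh.le] at this
  have hfM := hM p hpK w hw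
  have hvM : ‖v‖ ≤ M + η := by
    have := norm_add_le (v - f p w) (f p w)
    rw [sub_add_cancel] at this
    linarith
  have m1 : x h ∈ s := hball <| by
    rw [Metric.mem_ball, dist_eq_norm]
    have := hxK h ⟨hh.le, le_rfl⟩
    nlinarith [mul_pos hh hη0]
  have m2 : p + h • v ∈ s := hball <| by
    rw [Metric.mem_ball, dist_eq_norm, add_sub_cancel_left, norm_smul, Real.norm_of_nonneg hh.le]
    exact (mul_le_mul_of_nonneg_left hvM hh.le).trans_lt hhρ
  have hVd := hL.dist_le_mul _ m1 _ m2
  rw [Real.dist_eq, dist_eq_norm] at hVd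
  have hd : ‖x h - (p + h • v)‖ ≤ 2 * η * h := by
    have e : x h - (p + h • v) = (x h - p - h • f p w) - h • (v - f p w) := by
      rw [smul_sub]; abel
    rw [e]
    refine (norm_sub_le _ _).trans ?_
    rw [norm_smul, Real.norm_of_nonneg hh.le]
    nlinarith
  have h5 := (le_abs_self _).trans (hVd.trans (mul_le_mul_of_nonneg_left hd hL0))
  nlinarith [mul_lt_mul_of_pos_right hLη hh]

/-- Uniform version of the decrease on the shell `ε / 4 ≤ V ≤ ε`. -/
theorem LocalCLFConditions.exists_uniform_decrease (hsys : SystemConditions U G G₁ f)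
    (hV : LocalCLFConditions U G f Ω V c) (hε : 0 < ε) (hεc : ε ≤ c) :
    ∃ d > 0, ∃ h₀ > 0, ∀ q ∈ {x ∈ closure Ω | V x ≤ ε}, ∃ h, h₀ ≤ h ∧
      ∃ q' ∈ {x ∈ closure Ω | V x ≤ max (ε / 2) (V q - d)},
        Reaches U f {y ∈ Ω | V y ≤ 2 * ε} h q q' := by
  obtain ⟨w₀, hw₀⟩ := hV.controls_nonempty
  obtain ⟨K, hK, hKG, htraj⟩ := hsys.exists_trajectory (hV.isCompact_sublevel ε)
    ((hV.sublevel_subset hεc).trans hV.Ω_subset) 1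
  obtain ⟨M, C, hM0, hC, hM, hlip⟩ := hsys.exists_bound_lipschitz hK hKG
  have hshell : ∀ a, a ≤ ε → 0 < a → ∃ δ > 0, ∀ q ∈ {x ∈ closure Ω | V x ≤ a}, ∀ y,
      ‖y - q‖ < δ → y ∈ Ω ∧ V y < 2 * a := fun a ha ha0 => by
    obtain ⟨δ, hδ, hsub⟩ := (hV.isCompact_sublevel a).exists_thickening_subset_open
      (hV.isOpen_lt (2 * a)) fun x hx =>
        ⟨hV.sublevel_subset (ha.trans hεc) hx, hx.2.trans_lt (by linarith)⟩
    refine ⟨δ, hδ, fun q hq y hy => hsub ?_⟩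
    rw [Metric.mem_thickening_iff]
    exact ⟨q, hq, by rwa [dist_eq_norm]⟩
  obtain ⟨δ₁, hδ₁, hδ₁V⟩ := hshell ε le_rfl hε
  -- No decrease is available near the origin. From `V ≤ ε / 4`, however, any control keeps `V < ε /
  -- 2` for time `δ`, so a step of definite length is still possible.
  obtain ⟨δ₂, hδ₂, hδ₂V⟩ := hshell (ε / 4) (by linarith) (by linarith)
  set δ := min 1 (min δ₁ δ₂ / (M + 1)) with hδdef
  have hδ : 0 < δ := lt_min one_pos (div_pos (lt_min hδ₁ hδ₂) (by linarith))
  have hδ1 : δ ≤ 1 := min_le_left _ _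
  have hMδ : M * δ < min δ₁ δ₂ := by
    have := (le_div_iff₀ (by linarith : 0 < M + 1)).1
      (min_le_right 1 (min δ₁ δ₂ / (M + 1)))
    rw [← hδdef] at this
    linarith
  have hnear : ∀ {q u x}, IsTrajectoryOn f (G ∩ K) (Icc 0 1) q u x → IsBorelControl U u →
      ∀ t ∈ Icc 0 δ, ‖x t - q‖ < min δ₁ δ₂ := fun hx hu t ht =>
    (hx.norm_sub_le (fun z hz w hw => hM z hz.2 w hw) hu.2 ⟨ht.1, ht.2.trans hδ1⟩).trans_lt
      ((mul_le_mul_of_nonneg_left ht.2 hM0.le).trans_lt hMδ)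
  have hconst : ∀ w ∈ U, IsBorelControl U fun _ => w := fun w hw => ⟨measurable_const, fun _ => hw⟩
  have hreach : ∀ {q u x}, q ∈ {x ∈ closure Ω | V x ≤ ε} →
      IsTrajectoryOn f (G ∩ K) (Icc 0 1) q u x → IsBorelControl U u → ∀ h ∈ Icc 0 δ,
      Reaches U f {y ∈ Ω | V y ≤ 2 * ε} h q (x h) := fun {q u x} hq hx hu h hh =>
    ⟨hh.1, u, hu, x, hx.mono (Icc_subset_Icc_right (hh.2.trans hδ1)) fun t ht _ => by
      have := hδ₁V q hq (x t) ((hnear hx hu t ⟨ht.1, ht.2.trans hh.2⟩).trans_le (min_le_left _ _))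
      exact ⟨this.1, this.2.le⟩, rfl⟩
  have hA : IsCompact {x ∈ closure Ω | V x ∈ Icc (ε / 4) ε} :=
    hV.proper_V (Icc (ε / 4) ε) isCompact_Icc
  obtain ⟨d, hd, h₀, hh₀, hstep⟩ : ∃ d > 0, ∃ h₀ > 0, ∀ q ∈ {x ∈ closure Ω | V x ∈ Icc (ε / 4) ε},
      q ∈ {x ∈ closure Ω | V x ∈ Icc (ε / 4) ε} → ∃ w ∈ U, ∃ h ∈ Icc h₀ δ, ∀ x,
        IsTrajectoryOn f (G ∩ K) (Icc 0 1) q (fun _ => w) x → V (x h) ≤ V q - d := by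
    -- Shell membership is repeated as a hypothesis because the induction ranges over arbitrary sets
    -- `s`, including full neighbourhoods of shell points.
    refine hA.induction_on (p := fun s => ∃ d > 0, ∃ h₀ > 0, ∀ q ∈ s,
      q ∈ {x ∈ closure Ω | V x ∈ Icc (ε / 4) ε} → ∃ w ∈ U, ∃ h ∈ Icc h₀ δ, ∀ x,
        IsTrajectoryOn f (G ∩ K) (Icc 0 1) q (fun _ => w) x → V (x h) ≤ V q - d) ?_ ?_ ?_ ?_
    · exact ⟨1, one_pos, 1, one_pos, fun q hq => hq.elim⟩
    · rintro s t hst ⟨d, hd, h₀, hh₀, h⟩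
      exact ⟨d, hd, h₀, hh₀, fun q hq => h q (hst hq)⟩
    · rintro s t ⟨d, hd, h₀, hh₀, h⟩ ⟨d', hd', h₀', hh₀', h'⟩
      refine ⟨min d d', lt_min hd hd', min h₀ h₀', lt_min hh₀ hh₀', fun q hq hqA => ?_⟩
      rcases hq with hq | hq
      · obtain ⟨w, hw, r, hr, H⟩ := h q hq hqA
        exact ⟨w, hw, r, ⟨(min_le_left _ _).trans hr.1, hr.2⟩, fun x hx =>
          (H x hx).trans (by linarith [min_le_left d d'])⟩
      · obtain ⟨w, hw, r, hr, H⟩ := h' q hq hqA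
        exact ⟨w, hw, r, ⟨(min_le_right _ _).trans hr.1, hr.2⟩, fun x hx =>
          (H x hx).trans (by linarith [min_le_right d d'])⟩
    · intro q₀ hq₀
      have hq₀ε : q₀ ∈ {x ∈ closure Ω | V x ≤ ε} := ⟨hq₀.1, hq₀.2.2⟩
      have hq₀Ω := hV.sublevel_subset hεc hq₀ε
      have hq₀0 : q₀ ≠ 0 := by
        rintro rfl
        have := hq₀.2.1
        rw [hV.posDef_V.1] at this
        linarith
      have hq₀K : q₀ ∈ K := by
        obtain ⟨x, hx⟩ := htraj q₀ hq₀ε _ (hconst w₀ hw₀)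
        rw [← hx.apply_zero ⟨le_rfl, zero_le_one⟩]
        exact (hx 0 ⟨le_rfl, zero_le_one⟩).1.2
      obtain ⟨w, hw, h, hh, hdec⟩ := hV.exists_control_decrease hM0 hC hM hlip hq₀Ω hq₀K hq₀0 hδ
      obtain ⟨x₀, hx₀⟩ := htraj q₀ hq₀ε _ (hconst w hw)
      have hgap := hdec 1 (hh.2.le.trans hδ1) x₀ (hx₀.mono le_rfl fun _ _ h => h.2)
      -- A third of the gap each goes to the variation of the endpoint value, to that of `V q`, and
      -- to the drop that remains.
      set d := (V q₀ - V (x₀ h)) / 3 with hd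
      have hd0 : 0 < d := by rw [hd]; linarith
      have hx₀Ω : x₀ h ∈ Ω := (hδ₁V q₀ hq₀ε _ ((hnear hx₀ (hconst w hw) h
        ⟨hh.1.le, hh.2.le⟩).trans_le (min_le_left _ _))).1
      obtain ⟨ρ, hρ, hball⟩ := Metric.eventually_nhds_iff.1
        ((hV.continuousAt hx₀Ω).eventually_lt_const (u := V (x₀ h) + d) (by linarith))
      have hexp : ∀ᶠ q in 𝓝 q₀, ‖q - q₀‖ * Real.exp (C * h) < ρ := by
        have hc : Continuous fun q => ‖q - q₀‖ * Real.exp (C * h) := by fun_prop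
        have := hc.tendsto q₀
        simp only [sub_self, norm_zero, zero_mul] at this
        exact this.eventually_lt_const hρ
      refine ⟨_, mem_nhdsWithin_of_mem_nhds (hexp.and ((hV.continuousAt hq₀Ω).eventually_const_lt
        (u := V q₀ - d) (by linarith))), d, hd0, h, hh.1, fun q hq hqA => ⟨w, hw, h,
          ⟨le_rfl, hh.2.le⟩, fun x hx => ?_⟩⟩
      have hdist := hx.norm_sub_le_exp hx₀ hC.le
        (fun z hz z' hz' w hw => hlip z hz.2 z' hz'.2 w hw) (fun _ => hw)
        ⟨hh.1.le, hh.2.le.trans hδ1⟩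
      have := hball (y := x h) (by rw [dist_eq_norm]; exact hdist.trans_lt hq.1)
      have h2 := hq.2
      linarith
  refine ⟨d, hd, min h₀ δ, lt_min hh₀ hδ, fun q hq => ?_⟩
  rcases le_or_gt (V q) (ε / 4) with hle | hgt
  · obtain ⟨x, hx⟩ := htraj q hq _ (hconst w₀ hw₀)
    have h1 := hδ₂V q ⟨hq.1, hle⟩ (x δ) ((hnear hx (hconst w₀ hw₀) δ ⟨hδ.le, le_rfl⟩).trans_le
      (min_le_right _ _))
    exact ⟨δ, min_le_right _ _, x δ, ⟨subset_closure h1.1, le_max_of_le_left (by linarith [h1.2])⟩,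
      hreach hq hx (hconst w₀ hw₀) δ ⟨hδ.le, le_rfl⟩⟩
  · have hqA : q ∈ {x ∈ closure Ω | V x ∈ Icc (ε / 4) ε} := ⟨hq.1, hgt.le, hq.2⟩
    obtain ⟨w, hw, h, hh, H⟩ := hstep q hqA hqA
    obtain ⟨x, hx⟩ := htraj q hq _ (hconst w hw)
    have hh' : h ∈ Icc 0 δ := ⟨hh₀.le.trans hh.1, hh.2⟩
    have h1 := hδ₁V q hq (x h) ((hnear hx (hconst w hw) h hh').trans_le (min_le_left _ _))
    exact ⟨h, (min_le_left _ _).trans hh.1, x h, ⟨subset_closure h1.1,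
      le_max_of_le_right (H x hx)⟩, hreach hq hx (hconst w hw) h hh'⟩

theorem LocalCLFConditions.exists_reaches_half (hsys : SystemConditions U G G₁ f)
    (hV : LocalCLFConditions U G f Ω V c) (hε : 0 < ε) (hεc : ε ≤ c)
    (hp : p ∈ {x ∈ closure Ω | V x ≤ ε}) :
    ∃ q ∈ {x ∈ closure Ω | V x ≤ ε / 2}, ∃ T, 1 ≤ T ∧
      Reaches U f {y ∈ Ω | V y ≤ 2 * ε} T p q := by
  obtain ⟨d, hd, h₀, hh₀, hstep⟩ := hV.exists_uniform_decrease hsys hε hεc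
  have hiter : ∀ N : ℕ, ∃ q ∈ {x ∈ closure Ω | V x ≤ max (ε / 2) (ε - N * d)}, ∃ T,
      N * h₀ ≤ T ∧ Reaches U f {y ∈ Ω | V y ≤ 2 * ε} T p q := fun N => by
    induction N with
    | zero =>
      refine ⟨p, ⟨hp.1, le_max_of_le_right (by simpa using hp.2)⟩, 0, by simp,
        Reaches.refl hV.controls_nonempty ⟨hV.sublevel_subset hεc hp, hp.2.trans (by linarith)⟩⟩
    | succ N ih =>
      obtain ⟨q, hq, T, hT, hpq⟩ := ih
      have hqε : V q ≤ ε := hq.2.trans (max_le (by linarith)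
        (by have : 0 ≤ N * d := by positivity
            linarith))
      obtain ⟨h, hh, q', hq', hqq'⟩ := hstep q ⟨hq.1, hqε⟩
      refine ⟨q', ⟨hq'.1, hq'.2.trans (max_le (le_max_left _ _) ?_)⟩, T + h, ?_, hpq.trans hqq'⟩
      · rcases le_max_iff.1 hq.2 with h1 | h1
        · exact le_max_of_le_left (by linarith)
        · exact le_max_of_le_right (by push_cast; linarith)
      · push_cast
        linarith
  -- `N₁` steps last at least one time unit, as gluing infinitely many arcs requires; `N₂` steps
  -- exhaust the level `ε`.
  obtain ⟨N₁, hN₁⟩ := exists_nat_ge (1 / h₀)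
  obtain ⟨N₂, hN₂⟩ := exists_nat_ge (ε / d)
  rw [div_le_iff₀ hh₀] at hN₁
  rw [div_le_iff₀ hd] at hN₂
  obtain ⟨q, hq, T, hT, hpq⟩ := hiter (N₁ + N₂)
  push_cast at hT hq
  have e1 : 0 ≤ (N₂ : ℝ) * h₀ := by positivity
  have e2 : 0 ≤ (N₁ : ℝ) * d := by positivity
  exact ⟨q, ⟨hq.1, hq.2.trans (max_le le_rfl (by linarith))⟩, T, by linarith, hpq⟩

theorem LocalCLFConditions.sublevel_subset_nullControllabilityRegion
    (hsys : SystemConditions U G G₁ f) (hV : LocalCLFConditions U G f Ω V c) :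
    {x ∈ closure Ω | V x ≤ c} ⊆ nullControllabilityRegion U G f := by
  intro p hp
  set e : ℕ → ℝ := fun k => c / 2 ^ k with he
  have he0 : ∀ k, 0 < e k := fun k => div_pos hV.c_pos (by positivity)
  have hec : ∀ k, e k ≤ c := fun k =>
    div_le_self hV.c_pos.le (one_le_pow₀ one_le_two)
  have hes : ∀ k, e k / 2 = e (k + 1) := fun k => by simp only [he, pow_succ, div_div]
  have hanti : Antitone e := antitone_nat_of_succ_le fun k => by
    rw [← hes]; linarith [he0 k]
  choose g hg τ hτ hgr using fun (k : ℕ) (q : {x // x ∈ {x ∈ closure Ω | V x ≤ e k}}) =>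
    hV.exists_reaches_half hsys (he0 k) (hec k) q.2
  -- The endpoint of arc `k`, with level at most `e k / 2 = e (k + 1)`, starts arc `k + 1`.
  let P : ∀ k, {x // x ∈ {x ∈ closure Ω | V x ≤ e k}} := fun k =>
    Nat.rec ⟨p, hp.1, by simpa [he] using hp.2⟩ (fun k q => ⟨g k q, (hes k) ▸ hg k q⟩) k
  have hS : Antitone fun k => {y ∈ Ω | V y ≤ 2 * e k} := fun j k hjk y hy =>
    ⟨hy.1, hy.2.trans (by linarith [hanti hjk])⟩
  have hP : ∀ k, Reaches U f {y ∈ Ω | V y ≤ 2 * e k} (τ k (P k)) (P k).1 (P (k + 1)).1 :=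
    fun k => hgr k (P k)
  obtain ⟨u, hu, x, hx, hxS⟩ := exists_trajectory_of_reaches (U := U) (f := f)
    (S := fun k => {y ∈ Ω | V y ≤ 2 * e k}) (τ := fun k => τ k (P k)) (p := fun k => (P k).1)
    hS (fun k => hτ k (P k)) hP
  rw [mem_nullControllabilityRegion_iff hsys.compact_U]
  refine ⟨u, hu, x, hx.mono le_rfl fun t _ h => hV.Ω_subset h.1, ?_⟩
  rw [tendsto_zero_iff_norm_tendsto_zero, Metric.tendsto_nhds]
  intro η hη
  have hlim : Tendsto (fun k => 2 * e k) atTop (𝓝[>] 0) := by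
    refine tendsto_nhdsWithin_iff.2 ⟨?_, Eventually.of_forall fun k => ?_⟩
    · have := (tendsto_pow_atTop_nhds_zero_of_lt_one (r := (1 / 2 : ℝ)) (by norm_num)
        (by norm_num)).const_mul (2 * c)
      rw [mul_zero] at this
      refine this.congr fun k => ?_
      simp only [he, one_div, inv_pow]
      ring
    · exact mul_pos two_pos (he0 k)
  obtain ⟨k, hk⟩ := ((hV.sublevel_shrink.comp hlim).eventually_lt_const
    (ENNReal.ofReal_pos.2 hη)).exists
  filter_upwards [hxS k] with t ht
  have h1 : ‖x t‖ₑ < ENNReal.ofReal η :=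
    (le_iSup₂ (f := fun y (_ : y ∈ {x ∈ closure Ω | V x ≤ 2 * e k}) => ‖y‖ₑ) (x t)
      ⟨subset_closure ht.1, ht.2⟩).trans_lt hk
  rw [← ofReal_norm, ENNReal.ofReal_lt_ofReal_iff hη] at h1
  simpa using h1

end Lyapunov

/-! ### Topology and invariance of the region. -/

section Region

variable {n m : ℕ} {U : Set (EuclideanSpace ℝ (Fin m))} {G G₁ Ω : Set (EuclideanSpace ℝ (Fin n))}
  {f : EuclideanSpace ℝ (Fin n) → EuclideanSpace ℝ (Fin m) → EuclideanSpace ℝ (Fin n)}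
  {V : EuclideanSpace ℝ (Fin n) → ℝ} {c : ℝ}

/-- The system is autonomous, so the tail solves it under the shifted control and has the same
limit. -/
theorem IsTrajectoryOn.mem_nullControllabilityRegion (hU : IsCompact U)
    {p : EuclideanSpace ℝ (Fin n)} {u : ℝ → EuclideanSpace ℝ (Fin m)}
    {x : ℝ → EuclideanSpace ℝ (Fin n)} (hu : IsBorelControl U u)
    (hx : IsTrajectoryOn f G (Ici 0) p u x) (hlim : Tendsto x atTop (𝓝 0)) {t : ℝ} (ht : 0 ≤ t) :
    x t ∈ nullControllabilityRegion U G f :=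
  (mem_nullControllabilityRegion_iff hU).2 ⟨_, hu.comp_add t, _, hx.comp_add ht,
    hlim.comp (tendsto_atTop_add_const_right _ t tendsto_id)⟩

theorem LocalCLFConditions.zero_mem_sublevel (hV : LocalCLFConditions U G f Ω V c) :
    (0 : EuclideanSpace ℝ (Fin n)) ∈ {x ∈ closure Ω | V x < c} :=
  ⟨subset_closure hV.zero_mem, hV.posDef_V.1.trans_lt hV.c_pos⟩

theorem LocalCLFConditions.exists_mem_sublevel (hV : LocalCLFConditions U G f Ω V c)
    {x : ℝ → EuclideanSpace ℝ (Fin n)} (hlim : Tendsto x atTop (𝓝 0)) :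
    ∃ T, 0 ≤ T ∧ x T ∈ {x ∈ closure Ω | V x < c} := by
  obtain ⟨T, h1, h2⟩ := ((eventually_ge_atTop (0 : ℝ)).and
    (hlim.eventually (hV.open_sublevel.mem_nhds hV.zero_mem_sublevel))).exists
  exact ⟨T, h1, h2⟩

theorem isOpen_nullControllabilityRegion (hsys : SystemConditions U G G₁ f)
    (hV : LocalCLFConditions U G f Ω V c) : IsOpen (nullControllabilityRegion U G f) := by
  rw [isOpen_iff_mem_nhds]
  intro p hp
  have hpG : p ∈ G := hp.1
  obtain ⟨u, hu, x, hx, hlim⟩ := (mem_nullControllabilityRegion_iff hsys.compact_U).1 hp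
  obtain ⟨T, hT, hxT⟩ := hV.exists_mem_sublevel hlim
  obtain ⟨r, hr, hrG⟩ := Metric.nhds_basis_closedBall.mem_iff.1 (hsys.open_G.mem_nhds hpG)
  obtain ⟨K, hK, hKG, htraj⟩ := hsys.exists_trajectory (isCompact_closedBall p r) hrG T
  have hxI : IsTrajectoryOn f G (Icc 0 T) p u x := hx.mono Icc_subset_Ici_self fun _ _ => id
  -- The reference trajectory need not lie in `K`, so its compact image is added to obtain one
  -- Lipschitz constant for both curves.
  have hK' : IsCompact (K ∪ x '' Icc 0 T) := hK.union (isCompact_Icc.image_of_continuousOn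
    hxI.continuousOn)
  obtain ⟨M, C, -, hC, -, hlip⟩ := hsys.exists_bound_lipschitz hK' (union_subset hKG
    (image_subset_iff.2 fun t ht => subset_closure (hxI t ht).1))
  obtain ⟨ρ, hρ, hball⟩ := Metric.isOpen_iff.1 hV.open_sublevel _ hxT
  have hexp : ∀ᶠ q in 𝓝 p, ‖q - p‖ * Real.exp (C * T) < ρ := by
    have hc : Continuous fun q => ‖q - p‖ * Real.exp (C * T) := by fun_prop
    have := hc.tendsto p
    simp only [sub_self, norm_zero, zero_mul] at this
    exact this.eventually_lt_const hρ
  filter_upwards [hexp, Metric.closedBall_mem_nhds p hr] with q hq hqr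
  obtain ⟨y, hy⟩ := htraj q hqr u hu
  have hdist := (hy.mono (S' := K ∪ x '' Icc 0 T) le_rfl fun _ _ h => Or.inl h.2).norm_sub_le_exp
    (hxI.mono le_rfl fun t ht _ => Or.inr (mem_image_of_mem x ht)) hC.le hlip hu.2 ⟨hT, le_rfl⟩
  have hyT := hball (show y T ∈ Metric.ball (x T) ρ by
    rw [Metric.mem_ball, dist_eq_norm]; exact hdist.trans_lt hq)
  have hreach : Reaches U f G T q (y T) := ⟨hT, u, hu, y, hy.mono le_rfl fun _ _ h => h.1, rfl⟩
  exact hreach.mem_nullControllabilityRegion hsys.compact_U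
    (hV.sublevel_subset_nullControllabilityRegion hsys ⟨hyT.1, hyT.2.le⟩)

theorem isConnected_nullControllabilityRegion (hsys : SystemConditions U G G₁ f)
    (hV : LocalCLFConditions U G f Ω V c) : IsConnected (nullControllabilityRegion U G f) := by
  have hsub : {x ∈ closure Ω | V x < c} ⊆ nullControllabilityRegion U G f := fun x hx =>
    hV.sublevel_subset_nullControllabilityRegion hsys ⟨hx.1, hx.2.le⟩
  refine ⟨⟨0, hsub hV.zero_mem_sublevel⟩, isPreconnected_of_forall 0 fun p hp => ?_⟩
  obtain ⟨u, hu, x, hx, hlim⟩ := (mem_nullControllabilityRegion_iff hsys.compact_U).1 hp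
  obtain ⟨T, hT, hxT⟩ := hV.exists_mem_sublevel hlim
  have hxI : IsTrajectoryOn f G (Icc 0 T) p u x := hx.mono Icc_subset_Ici_self fun _ _ => id
  -- The arc from `p` meets the connected sublevel set at `x T`, so the union connects `p` to `0`.
  refine ⟨{x ∈ closure Ω | V x < c} ∪ x '' Icc 0 T, union_subset hsub ?_,
    Or.inl hV.zero_mem_sublevel, Or.inr ⟨0, ⟨le_rfl, hT⟩, hx.apply_zero self_mem_Ici⟩, ?_⟩
  · rintro _ ⟨t, ht, rfl⟩
    exact hx.mem_nullControllabilityRegion hsys.compact_U hu hlim ht.1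
  · exact hV.connected_sublevel.isPreconnected.union (x T) hxT (mem_image_of_mem x ⟨hT, le_rfl⟩)
      (isPreconnected_Icc.image x hxI.continuousOn)

end Region

theorem proposition2p14 {n m : ℕ} (U : Set (EuclideanSpace ℝ (Fin m)))
    (G G₁ : Set (EuclideanSpace ℝ (Fin n)))
    (f : EuclideanSpace ℝ (Fin n) → EuclideanSpace ℝ (Fin m) → EuclideanSpace ℝ (Fin n))
    (hsys : SystemConditions U G G₁ f)
    (hconv : ∀ x ∈ closure G, Convex ℝ ((fun u => f x u) '' U))
    (Ω : Set (EuclideanSpace ℝ (Fin n))) (V : EuclideanSpace ℝ (Fin n) → ℝ) (c : ℝ)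
    (hV : LocalCLFConditions U G f Ω V c) :
    IsOpen (nullControllabilityRegion U G f) ∧
    IsConnected (nullControllabilityRegion U G f) ∧
    {x ∈ closure Ω | V x ≤ c} ⊆ nullControllabilityRegion U G f ∧
    ∀ x₀ ∈ nullControllabilityRegion U G f, ∃ u ∈ AdmissibleControls U,
      ∃ x : ℝ → EuclideanSpace ℝ (Fin n), IsTrajectory f G ⊤ x₀ u x ∧
        ∀ t : ℝ, 0 ≤ t → x t ∈ nullControllabilityRegion U G f := by
  refine ⟨isOpen_nullControllabilityRegion hsys hV, isConnected_nullControllabilityRegion hsys hV,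
    hV.sublevel_subset_nullControllabilityRegion hsys, fun x₀ hx₀ => ?_⟩
  obtain ⟨u, hu, x, hx, hlim⟩ := (mem_nullControllabilityRegion_iff hsys.compact_U).1 hx₀
  exact ⟨u, hu.mem_admissibleControls hsys.compact_U, x, isTrajectoryOn_Ici_iff.1 hx,
    fun t ht => hx.mem_nullControllabilityRegion hsys.compact_U hu hlim ht⟩
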